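/- **Theorem 1 (physicality of filtering maps).** Consider a single bosonic mode with creation and annihilation operators $a^\dagger,a$ and number states $|n\rangle$, $n\ge 0$. Let $D(\xi)=\exp(\xi a^\dagger-\xi^*a)$ be the displacement operators ($\xi\in\mathbb C$), and let $\Phi_\rho(\xi)=\mathrm{Tr}[\rho D(\xi)]$ be the characteristic function of a trace-class operator $\rho$. For a function $\Omega:\mathbb C\to\mathbb C$ (the filter), the filtering map $\mathcal E_\Omega$ is the linear map on trace-class operators that multiplies characteristic functions by $\Omega$: $\Phi_{\mathcal E_\Omega(\rho)}(\xi)=\Phi_\rho(\xi)\,\Omega(\xi)$ for all $\rho$ and $\xi$. CPTP means completely positive and trace preserving; $d^2\alpha=d(\mathrm{Re}\,\alpha)\,d(\mathrm{Im}\,\alpha)$. (i) For every $\Omega:\mathbb C\to\mathbb C$: the filtering map $\mathcal E_\Omega$ exists on trace-class operators and is CPTP if and only if $\Omega$ is the Fourier transform of a probability distribution, that is, $\Omega(\xi)=\int e^{\xi\alpha^*-\alpha\xi^*}\,d\mu(\alpha)$ for all $\xi$, for some Borel probability measure $\mu$ on $\mathbb C$. (ii) Suppose that $\Omega(\xi)=\int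 \tilde\Omega(\alpha)\,e^{\xi\alpha^*-\alpha\xi^*}\,d^2\alpha$ for all $\xi$, with an integrable function $\tilde\Omega:\mathbb C\to\mathbb C$. Then the formula $$\mathcal E(\rho)=\int \tilde\Omega(\alpha)\,D(\alpha)\,\rho\,D(\alpha)^\dagger\,d^2\alpha$$ (a weak integral) defines a linear map on trace-class operators. This map is a filtering map of $\Omega$, and it is CPTP if and only if $\tilde\Omega$ is a probability density, i.e. $\tilde\Omega\ge 0$ almost everywhere and $\int\tilde\Omega(\alpha)\,d^2\alpha=1$. (iii) Suppose that $\Omega$ is continuous and integrable, and let $\tilde\Omega(\alpha)=\frac1{\pi^2}\int\Omega(\xi)\,e^{\alpha\xi^*-\xi\alpha^*}\,d^2\xi$ be its Fourier transform. Then $\mathcal E_\Omega$ exists on trace-class operators and is CPTP if and only if $\tilde\Omega$ is a probability density. -/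

import Mathlib

open MeasureTheory
open scoped ComplexConjugate InnerProductSpace Nat

noncomputable section

/-! ### The single bosonic mode -/

/-- The Hilbert space `ℓ²(ℕ)` of a single bosonic mode, in the number representation. -/
abbrev Fock : Type := lp (fun _ : ℕ => ℂ) 2

/-- The number state `|n⟩`. -/
def numberState (n : ℕ) : Fock := lp.single 2 n (1 : ℂ)

/-- The finite linear combinations of number states, inside `Fock`. -/
def toFock : (ℕ →₀ ℂ) →ₗ[ℂ] Fock := Finsupp.linearCombination ℂ numberState

/-- The creation operator `a† |n⟩ = √(n+1) |n+1⟩` on finite combinations of number states. -/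
def creation : Module.End ℂ (ℕ →₀ ℂ) :=
  Finsupp.linearCombination ℂ fun n => Finsupp.single (n + 1) ((√(n + 1 : ℝ) : ℝ) : ℂ)

/-- The annihilation operator `a |n⟩ = √n |n-1⟩`, `a |0⟩ = 0`. -/
def annihilation : Module.End ℂ (ℕ →₀ ℂ) :=
  Finsupp.linearCombination ℂ fun n => Finsupp.single (n - 1) ((√(n : ℝ) : ℝ) : ℂ)

/-- The generator `ξ a† - ξ* a`. -/
def dispGen (ξ : ℂ) : Module.End ℂ (ℕ →₀ ℂ) := ξ • creation - conj ξ • annihilation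

/-- The `k`-th term of the exponential series of `ξ a† - ξ* a` applied to `|n⟩`. -/
def expTerm (ξ : ℂ) (n k : ℕ) : Fock :=
  ((k ! : ℂ))⁻¹ • toFock ((dispGen ξ ^ k) (Finsupp.single n 1))

lemma toFock_single (n : ℕ) (z : ℂ) : toFock (Finsupp.single n z) = z • numberState n := by
  simp [toFock]

lemma orthonormal_numberState : Orthonormal ℂ numberState := by
  rw [orthonormal_iff_ite]
  intro i j
  rw [numberState, lp.inner_single_left, numberState, lp.single_apply]
  by_cases h : i = j
  · subst h; simp
  · rw [Pi.single_eq_of_ne h]; simp [h]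

lemma norm_numberState (n : ℕ) : ‖numberState n‖ = 1 := orthonormal_numberState.1 n

lemma dispGen_single (ξ : ℂ) (n : ℕ) :
    dispGen ξ (Finsupp.single n 1) =
      (ξ * (√(n + 1 : ℝ) : ℝ)) • Finsupp.single (n + 1) 1
        - (conj ξ * (√(n : ℝ) : ℝ)) • Finsupp.single (n - 1) 1 := by
  simp [dispGen, creation, annihilation]

lemma norm_toFock_pow_le (ξ : ℂ) (k : ℕ) : ∀ n : ℕ,
    ‖toFock ((dispGen ξ ^ k) (Finsupp.single n 1))‖ ≤
      ∏ j ∈ Finset.range k, ((2 * ‖ξ‖ + 1) * √((n + j + 1 : ℕ) : ℝ)) := by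
  induction k with
  | zero => intro n; simp [toFock_single, norm_numberState]
  | succ k ih =>
    intro n
    have hmono : ∀ m m' : ℕ, m ≤ m' →
        ∏ j ∈ Finset.range k, ((2 * ‖ξ‖ + 1) * √((m + j + 1 : ℕ) : ℝ)) ≤
        ∏ j ∈ Finset.range k, ((2 * ‖ξ‖ + 1) * √((m' + j + 1 : ℕ) : ℝ)) := by
      intro m m' h
      gcongr
    rw [pow_succ, Module.End.mul_apply, dispGen_single, map_sub, map_smul, map_smul, map_sub,
      map_smul, map_smul, Finset.prod_range_succ']
    refine (norm_sub_le _ _).trans ?_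
    rw [norm_smul, norm_smul, norm_mul, norm_mul, Complex.norm_real, Complex.norm_real,
      RCLike.norm_conj, Real.norm_of_nonneg (Real.sqrt_nonneg _),
      Real.norm_of_nonneg (Real.sqrt_nonneg _)]
    set P := ∏ j ∈ Finset.range k, ((2 * ‖ξ‖ + 1) * √((n + 1 + j + 1 : ℕ) : ℝ)) with hP
    have e : ∏ j ∈ Finset.range k, ((2 * ‖ξ‖ + 1) * √((n + (j + 1) + 1 : ℕ) : ℝ)) = P := by
      refine Finset.prod_congr rfl fun j _ => ?_
      rw [show n + (j + 1) + 1 = n + 1 + j + 1 by ring]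
    rw [e]
    have h1 := ih (n + 1)
    have h2 := (ih (n - 1)).trans (hmono (n - 1) (n + 1) (by omega))
    have hP0 : 0 ≤ P := (norm_nonneg _).trans h1
    have hs : √(n : ℝ) ≤ √(n + 1 : ℝ) := Real.sqrt_le_sqrt (by linarith)
    have hc : √((n + 0 + 1 : ℕ) : ℝ) = √(n + 1 : ℝ) := by simp
    rw [hc]
    calc _ ≤ ‖ξ‖ * √(n + 1 : ℝ) * P + ‖ξ‖ * √(n + 1 : ℝ) * P := by gcongr
      _ ≤ P * ((2 * ‖ξ‖ + 1) * √(n + 1 : ℝ)) := by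
        have : 0 ≤ P * √(n + 1 : ℝ) := by positivity
        nlinarith

lemma summable_norm_expTerm (ξ : ℂ) (n : ℕ) : Summable fun k => ‖expTerm ξ n k‖ := by
  set c := 2 * ‖ξ‖ + 1 with hc
  have hc0 : 0 < c := by positivity
  let b : ℕ → ℝ := fun k =>
    ((k ! : ℝ))⁻¹ * ∏ j ∈ Finset.range k, (c * √((n + j + 1 : ℕ) : ℝ))
  have hb0 : ∀ k, 0 < b k := fun k => by
    refine mul_pos (by positivity) (Finset.prod_pos fun j _ => mul_pos hc0 ?_)
    exact Real.sqrt_pos.2 (by positivity)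
  refine Summable.of_nonneg_of_le (f := b) (fun _ => norm_nonneg _) ?_ ?_
  · intro k
    rw [expTerm, norm_smul, norm_inv, Complex.norm_natCast]
    exact mul_le_mul_of_nonneg_left (norm_toFock_pow_le ξ k n) (by positivity)
  · refine summable_of_ratio_test_tendsto_lt_one (l := 0) one_pos
      (Filter.Eventually.of_forall fun k => (hb0 k).ne') ?_
    have hr : ∀ k, ‖b (k + 1)‖ / ‖b k‖ = c * √((n + k + 1 : ℕ) : ℝ) / (k + 1) := by
      intro k
      rw [Real.norm_of_nonneg (hb0 _).le, Real.norm_of_nonneg (hb0 _).le]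
      have hp : 0 < ∏ j ∈ Finset.range k, (c * √((n + j + 1 : ℕ) : ℝ)) :=
        Finset.prod_pos fun j _ => mul_pos hc0 (Real.sqrt_pos.2 (by positivity))
      simp only [b]
      rw [Finset.prod_range_succ, Nat.factorial_succ]
      push_cast
      field_simp
    simp_rw [hr]
    have hle : ∀ k : ℕ, c * √((n + k + 1 : ℕ) : ℝ) / (k + 1) ≤
        c * √(n + 1 : ℝ) * √(1 / ((k : ℝ) + 1)) := by
      intro k
      have h1 : √((n + k + 1 : ℕ) : ℝ) ≤ √(n + 1 : ℝ) * √((k : ℝ) + 1) := by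
        rw [← Real.sqrt_mul (by positivity)]
        apply Real.sqrt_le_sqrt
        push_cast
        nlinarith [mul_nonneg (Nat.cast_nonneg (α := ℝ) n) (Nat.cast_nonneg (α := ℝ) k)]
      have h2 : √(1 / ((k : ℝ) + 1)) = √((k : ℝ) + 1) / (k + 1) := by
        rw [Real.sqrt_div_self', Real.sqrt_div zero_le_one, Real.sqrt_one]
      rw [h2]
      calc _ ≤ c * (√(n + 1 : ℝ) * √((k : ℝ) + 1)) / (k + 1) := by gcongr
        _ = _ := by ring
    refine squeeze_zero (fun k => by positivity) hle ?_
    have h0 : Filter.Tendsto (fun k : ℕ => √(1 / ((k : ℝ) + 1))) Filter.atTop (nhds 0) := by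
      have := (Real.continuous_sqrt.tendsto 0).comp
        (tendsto_one_div_add_atTop_nhds_zero_nat (𝕜 := ℝ))
      simpa [Function.comp_def] using this
    simpa using h0.const_mul (c * √(n + 1 : ℝ))

/-- `ξ a† - ξ* a` is skew-symmetric. -/
lemma inner_dispGen (ξ : ℂ) (u v : ℕ →₀ ℂ) :
    ⟪toFock (dispGen ξ u), toFock v⟫_ℂ = - ⟪toFock u, toFock (dispGen ξ v)⟫_ℂ := by
  induction u using Finsupp.induction_linear with
  | zero => simp
  | add u₁ u₂ h₁ h₂ => simp only [map_add, inner_add_left, h₁, h₂]; ring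
  | single m z =>
    induction v using Finsupp.induction_linear with
    | zero => simp
    | add v₁ v₂ h₁ h₂ => simp only [map_add, inner_add_right, h₁, h₂]; ring
    | single n w =>
      have hz : (Finsupp.single m z : ℕ →₀ ℂ) = z • Finsupp.single m 1 := by simp
      have hw : (Finsupp.single n w : ℕ →₀ ℂ) = w • Finsupp.single n 1 := by simp
      rw [hz, hw]
      simp only [map_smul, inner_smul_left, inner_smul_right, dispGen_single, map_sub,
        toFock_single, one_smul, inner_sub_left, inner_sub_right,
        orthonormal_iff_ite.1 orthonormal_numberState, map_mul, Complex.conj_conj,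
        Complex.conj_ofReal]
      by_cases h1 : m + 1 = n
      · subst h1
        have a1 : ¬ m - 1 = m + 1 := by omega
        have a2 : ¬ m = m + 1 + 1 := by omega
        simp [a2]
        ring_nf
        simp
      · by_cases h2 : n + 1 = m
        · subst h2
          have a1 : ¬ n + 1 + 1 = n := by omega
          have a2 : ¬ n + 1 = n - 1 := by omega
          simp [a1, a2]
          ring_nf
          simp
        · have a1 : ¬ m = n + 1 := fun h => h2 h.symm
          rcases m with _ | m <;> rcases n with _ | n <;> simp_all
          omega

lemma inner_dispGen_pow (ξ : ℂ) (j : ℕ) (u v : ℕ →₀ ℂ) :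
    ⟪toFock ((dispGen ξ ^ j) u), toFock v⟫_ℂ =
      (-1) ^ j * ⟪toFock u, toFock ((dispGen ξ ^ j) v)⟫_ℂ := by
  induction j generalizing v with
  | zero => simp
  | succ j ih =>
    rw [pow_succ', Module.End.mul_apply, inner_dispGen, ih, ← Module.End.mul_apply, ← pow_succ,
      pow_succ']
    ring_nf

/-- `exp(ξ a† - ξ* a) |n⟩`, the sum of the (norm convergent) exponential series. -/
def displaced (ξ : ℂ) (n : ℕ) : Fock := ∑' k, expTerm ξ n k

lemma hasSum_displaced (ξ : ℂ) (n : ℕ) : HasSum (expTerm ξ n) (displaced ξ n) :=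
  (summable_norm_expTerm ξ n).of_norm.hasSum

lemma orthonormal_displaced (ξ : ℂ) : Orthonormal ℂ (displaced ξ) := by
  rw [orthonormal_iff_ite]
  intro m n
  have hs : Summable fun p : ℕ × ℕ => ⟪expTerm ξ m p.1, expTerm ξ n p.2⟫_ℂ := by
    refine Summable.of_norm_bounded ((summable_norm_expTerm ξ m).mul_of_nonneg
      (summable_norm_expTerm ξ n) (fun _ => norm_nonneg _) fun _ => norm_nonneg _) fun p => ?_
    exact norm_inner_le_norm _ _
  have h1 : ⟪displaced ξ m, displaced ξ n⟫_ℂ =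
      ∑' p : ℕ × ℕ, ⟪expTerm ξ m p.1, expTerm ξ n p.2⟫_ℂ := by
    rw [hs.tsum_prod]
    have h2 : ∀ j, ∑' k, ⟪expTerm ξ m j, expTerm ξ n k⟫_ℂ = ⟪expTerm ξ m j, displaced ξ n⟫_ℂ :=
      fun j => ((hasSum_displaced ξ n).mapL (innerSL ℂ (expTerm ξ m j))).tsum_eq
    simp only [h2]
    exact (((hasSum_displaced ξ m).mapL (innerSLFlip ℂ (displaced ξ n))).tsum_eq).symm
  have h3 : ∀ N : ℕ, ∑ p ∈ Finset.HasAntidiagonal.antidiagonal N, ⟪expTerm ξ m p.1, expTerm ξ n p.2⟫_ℂ =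
      if N = 0 then (if m = n then 1 else 0) else 0 := by
    intro N
    have h4 : ∀ p ∈ Finset.HasAntidiagonal.antidiagonal N, ⟪expTerm ξ m p.1, expTerm ξ n p.2⟫_ℂ =
        (((N ! : ℂ))⁻¹ * ⟪numberState m, toFock ((dispGen ξ ^ N) (Finsupp.single n 1))⟫_ℂ) *
          (N.choose p.1 • ((-1 : ℂ) ^ p.1 * 1 ^ p.2)) := by
      intro p hp
      have hp' := Finset.HasAntidiagonal.mem_antidiagonal.1 hp
      have hf : ((N.choose p.1 : ℕ) : ℂ) = (N ! : ℂ) / ((p.1 ! : ℂ) * (p.2 ! : ℂ)) := by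
        rw [← hp', Nat.choose_symm_add, Nat.add_choose, Nat.cast_div (Nat.factorial_mul_factorial_dvd_factorial_add _ _)
          (by exact_mod_cast (Nat.mul_pos (Nat.factorial_pos _) (Nat.factorial_pos _)).ne'),
          Nat.cast_mul]
      have hN : (N ! : ℂ) ≠ 0 := by exact_mod_cast N.factorial_ne_zero
      rw [expTerm, expTerm, inner_smul_left, inner_smul_right, inner_dispGen_pow,
        ← Module.End.mul_apply, ← pow_add, hp', toFock_single, one_smul, nsmul_eq_mul, hf]
      simp only [map_inv₀, map_natCast, one_pow, mul_one]
      field_simp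
    rw [Finset.sum_congr rfl h4, ← Finset.mul_sum, ← (Commute.all (-1 : ℂ) 1).add_pow' N]
    rcases N with _ | N
    · simp [toFock_single, orthonormal_iff_ite.1 orthonormal_numberState]
    · simp
  rw [h1, ← (Finset.HasAntidiagonal.sigmaAntidiagonalEquivProd (A := ℕ)).tsum_eq
    (fun p : ℕ × ℕ => ⟪expTerm ξ m p.1, expTerm ξ n p.2⟫_ℂ)]
  have hs' := (Finset.HasAntidiagonal.sigmaAntidiagonalEquivProd (A := ℕ)).summable_iff.2 hs
  refine hs'.tsum_sigma.trans ?_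
  have h5 : ∀ N : ℕ, ∑' c : Finset.HasAntidiagonal.antidiagonal N,
      ⟪expTerm ξ m (Finset.HasAntidiagonal.sigmaAntidiagonalEquivProd ⟨N, c⟩).1,
        expTerm ξ n (Finset.HasAntidiagonal.sigmaAntidiagonalEquivProd ⟨N, c⟩).2⟫_ℂ =
      if N = 0 then (if m = n then 1 else 0) else 0 := by
    intro N
    rw [← h3 N, tsum_fintype]
    exact Finset.sum_coe_sort (Finset.HasAntidiagonal.antidiagonal N)
      fun p => ⟪expTerm ξ m p.1, expTerm ξ n p.2⟫_ℂ
  exact (tsum_congr h5).trans (tsum_ite_eq _ _)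

/-- The displacement operator `D(ξ) = exp(ξ a† - ξ* a)`: the bounded operator with
`D(ξ) |n⟩ = ∑ₖ (ξ a† - ξ* a)ᵏ |n⟩ / k!`. -/
def displacement (ξ : ℂ) : Fock →L[ℂ] Fock :=
  (orthonormal_displaced ξ).orthogonalFamily.linearIsometry.toContinuousLinearMap

lemma displacement_numberState (ξ : ℂ) (n : ℕ) : displacement ξ (numberState n) = displaced ξ n := by
  simp [displacement, numberState]

/-! ### Trace-class operators and the characteristic function -/

/-- The trace `∑ₙ ⟨n|T|n⟩`. -/
def opTrace (T : Fock →L[ℂ] Fock) : ℂ := ∑' n, ⟪numberState n, T (numberState n)⟫_ℂ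

/-- The trace-class operators: the linear span of the positive operators of finite trace. -/
def TraceClass : Submodule ℂ (Fock →L[ℂ] Fock) :=
  Submodule.span ℂ
    {P | P.IsPositive ∧ Summable fun n => ⟪numberState n, P (numberState n)⟫_ℂ}

/-- The characteristic function `Φ_ρ(ξ) = Tr[ρ D(ξ)]`. -/
def charFn (ρ : Fock →L[ℂ] Fock) (ξ : ℂ) : ℂ := opTrace (ρ ∘L displacement ξ)

/-! ### Quantum channels -/

/-- Positivity of the operator `∑ᵢⱼ ρᵢⱼ ⊗ |i⟩⟨j|` on `Fock ⊗ ℂᵏ`, where `Fock ⊗ ℂᵏ` is identified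
with the `k`-tuples of vectors of `Fock`. Such an operator is trace class iff all `ρᵢⱼ` are. -/
def IsPositiveBlock {k : ℕ} (ρ : Fin k → Fin k → TraceClass) : Prop :=
  ∀ x : Fin k → Fock,
    0 ≤ (∑ i, ∑ j, ⟪x i, (ρ i j : Fock →L[ℂ] Fock) (x j)⟫_ℂ).re ∧
    (∑ i, ∑ j, ⟪x i, (ρ i j : Fock →L[ℂ] Fock) (x j)⟫_ℂ).im = 0

/-- Complete positivity: `E ⊗ id` preserves positivity on `Fock ⊗ ℂᵏ`, for every `k`. -/
def IsCompletelyPositive (E : TraceClass →ₗ[ℂ] TraceClass) : Prop :=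
  ∀ (k : ℕ) (ρ : Fin k → Fin k → TraceClass),
    IsPositiveBlock ρ → IsPositiveBlock fun i j => E (ρ i j)

/-- Trace preservation. -/
def IsTracePreserving (E : TraceClass →ₗ[ℂ] TraceClass) : Prop :=
  ∀ ρ : TraceClass, opTrace (E ρ) = opTrace ρ

/-- Completely positive trace-preserving maps. -/
def IsCPTP (E : TraceClass →ₗ[ℂ] TraceClass) : Prop :=
  IsCompletelyPositive E ∧ IsTracePreserving E

/-! ### Filtering maps -/

/-- `E` is the filtering map of `Ω`: it multiplies characteristic functions by `Ω`. -/
def IsFilteringMap (Ω : ℂ → ℂ) (E : TraceClass →ₗ[ℂ] TraceClass) : Prop :=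
  ∀ (ρ : TraceClass) (ξ : ℂ), charFn (E ρ) ξ = charFn ρ ξ * Ω ξ

/-- `E(ρ) = ∫ p(α) D(α) ρ D(α)† d²α`, the integral being taken in the weak sense;
`d²α = d(Re α) d(Im α)` is the Lebesgue measure of `ℂ`. -/
def IsDisplacementIntegral (p : ℂ → ℂ) (E : TraceClass →ₗ[ℂ] TraceClass) : Prop :=
  ∀ (ρ : TraceClass) (x y : Fock),
    ⟪x, (E ρ : Fock →L[ℂ] Fock) y⟫_ℂ =
      ∫ α : ℂ, p α *
        ⟪x, (displacement α ∘L (ρ : Fock →L[ℂ] Fock) ∘L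
          ContinuousLinearMap.adjoint (displacement α)) y⟫_ℂ

/-- The symplectic Fourier kernel `exp(ξ α* - α ξ*)`. -/
def fourierKernel (ξ α : ℂ) : ℂ := Complex.exp (ξ * conj α - α * conj ξ)

/-- `p` is a probability density on the complex plane (with respect to `d²α`). -/
def IsProbabilityDensity (p : ℂ → ℂ) : Prop :=
  Integrable p ∧ (∀ᵐ α, 0 ≤ (p α).re ∧ (p α).im = 0) ∧ ∫ α, p α = 1

end

/-! Everything rests on the Weyl relation `displacement_mul`, D(ξ)D(η) = e^{(ξη* - ξ*η)/2} D(ξ+η).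
It gives D(-α) D(ξ) D(α) = `fourierKernel ξ α` • D(ξ) (`displacement_conj`): conjugating a state by
D(α) multiplies its characteristic function by a character of ξ. An average of such conjugations
therefore multiplies it by a Fourier transform (`IsWeakTwirl.charFn_eq`). With nonnegative weights
of total mass one the average is a mixture of unitary channels, hence CPTP. This settles
sufficiency, once the average is known to preserve the trace class (`IsWeakTwirl.mem_traceClass`).

For necessity, let `E` be a CPTP filtering map of Ω. Complete positivity makes Ω positive definite
(`IsFilteringMap.isPosDefFun`). One feeds `E` the positive block of rank-one operators |uᵢ⟩⟨uⱼ| with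
uᵢ = cᵢ D(-ξᵢ)|0⟩, tests the output on the vectors D(-ξᵢ)|m⟩ and sums over m. The sum is a trace
against D(-ξⱼ)D(ξᵢ), that is, up to a Weyl phase, a characteristic function at ξᵢ - ξⱼ; the phases
cancel and Σ c̄ⱼ cᵢ Ω(ξᵢ - ξⱼ) ≥ 0 remains. Ω is continuous, being locally a quotient of
characteristic functions of trace-class operators, and trace preservation gives Ω(0) = 1. Bochner's
theorem (`IsPosDefFun.exists_charFun_eq`) then supplies the probability measure.

If Ω is also the transform of an integrable p, then p d²α and that measure have equal transforms,
and uniqueness (`ae_nonneg_of_integral_eq_charFun_complex`) forces p ≥ 0 almost everywhere. If Ω is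
continuous and integrable, positive definiteness makes its Fourier transform nonnegative, hence
integrable, and Fourier inversion reduces this case to the previous one. -/

/-! ### Formal power series and the Baker–Campbell–Hausdorff identity -/

section PowerSeriesODE

open PowerSeries

variable {R : Type*} [Ring R]

/-- The formal derivative of a power series over a possibly noncommutative ring. -/
noncomputable def formalDeriv (F : PowerSeries R) : PowerSeries R :=
  PowerSeries.mk fun n => ((n : R) + 1) * coeff (n + 1) F

/-- Leibniz rule: split the weight N + 1 as the sum of the two degrees and move the natural number,
which is central, past the first factor. -/
lemma formalDeriv_mul (F G : PowerSeries R) :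
    formalDeriv (F * G) = formalDeriv F * G + F * formalDeriv G := by
  ext N
  simp only [formalDeriv, coeff_mk, coeff_mul, map_add]
  have h1 : ((N : R) + 1) * ∑ p ∈ Finset.HasAntidiagonal.antidiagonal (N + 1), coeff p.1 F * coeff p.2 G =
      ∑ p ∈ Finset.HasAntidiagonal.antidiagonal (N + 1), (p.1 : R) * (coeff p.1 F * coeff p.2 G) +
      ∑ p ∈ Finset.HasAntidiagonal.antidiagonal (N + 1), (p.2 : R) * (coeff p.1 F * coeff p.2 G) := by
    rw [Finset.mul_sum, ← Finset.sum_add_distrib]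
    refine Finset.sum_congr rfl fun p hp => ?_
    have := Finset.HasAntidiagonal.mem_antidiagonal.1 hp
    rw [← add_mul]
    congr 1
    exact_mod_cast congrArg (Nat.cast (R := R)) this.symm
  rw [h1, Finset.Nat.sum_antidiagonal_succ, Finset.Nat.sum_antidiagonal_succ']
  simp only [Nat.cast_zero, zero_mul, zero_add, Nat.cast_add, Nat.cast_one, mul_assoc]
  congr 1
  refine Finset.sum_congr rfl fun p _ => ?_
  rw [← mul_assoc, ← mul_assoc]
  congr 1
  exact ((Nat.cast_commute p.2 (coeff p.1 F)).add_left (Commute.one_left _)).eq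

variable [Algebra ℂ R]

/-- Uniqueness for F' = (A + ct)F. The equation reads (N+1)F_{N+1} = A F_N + c F_{N-1}, a two-term
recursion, so the induction carries two consecutive coefficients; N + 1 is invertible because R is a
ℂ-algebra. -/
lemma eq_of_formalDeriv_eq {F G : PowerSeries R} {A : R} {c : ℂ}
    (hF : formalDeriv F = (C A + c • X) * F) (hG : formalDeriv G = (C A + c • X) * G)
    (h0 : coeff 0 F = coeff 0 G) : F = G := by
  have key : ∀ N, coeff N F = coeff N G ∧ coeff (N + 1) F = coeff (N + 1) G := by
    have step : ∀ (N : ℕ), coeff N F = coeff N G → (∀ M, M + 1 = N → coeff M F = coeff M G) →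
        coeff (N + 1) F = coeff (N + 1) G := by
      intro N h h'
      have e1 := congrArg (coeff N) hF
      have e2 := congrArg (coeff N) hG
      simp only [formalDeriv, coeff_mk, add_mul, map_add, coeff_C_mul, smul_mul_assoc] at e1 e2
      have e3 : coeff N (c • (X * F)) = coeff N (c • (X * G)) := by
        have : coeff N (X * F) = coeff N (X * G) := by
          rcases N with _ | M
          · simp
          · rw [coeff_succ_X_mul, coeff_succ_X_mul, h' M rfl]
        have hs : ∀ H : PowerSeries R, coeff N (c • H) = c • coeff N H := fun H => rfl
        rw [hs, hs, this]
      rw [h, e3] at e1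
      have e4 : ((N : R) + 1) * coeff (N + 1) F = ((N : R) + 1) * coeff (N + 1) G :=
        by simpa only [add_mul] using e1.trans e2.symm
      have hN : ((N : ℂ) + 1) ≠ 0 := by exact_mod_cast N.succ_ne_zero
      have e5 : ∀ r : R, ((N : ℂ) + 1)⁻¹ • (((N : R) + 1) * r) = r := by
        intro r
        have : ((N : R) + 1) * r = ((N : ℂ) + 1) • r := by
          rw [Algebra.smul_def]; simp
        rw [this, smul_smul, inv_mul_cancel₀ hN, one_smul]
      rw [← e5 (coeff (N + 1) F), e4, e5]
    intro N
    induction N with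
    | zero => exact ⟨h0, step 0 h0 fun M hM => by omega⟩
    | succ N ih => exact ⟨ih.2, step _ ih.2 fun M hM => by
        obtain rfl : M = N := by omega
        exact ih.1⟩
  ext N
  exact (key N).1

/-- The formal series `e^{tA}`. -/
noncomputable def formalExp (A : R) : PowerSeries R := PowerSeries.mk fun n => ((n ! : ℂ))⁻¹ • A ^ n

lemma succ_mul_inv_factorial_smul (n : ℕ) (r : R) :
    ((n : R) + 1) * (((n + 1)! : ℂ)⁻¹ • r) = ((n ! : ℂ))⁻¹ • r := by
  have : ((n : R) + 1) = algebraMap ℂ R ((n : ℂ) + 1) := by simp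
  rw [this, ← Algebra.smul_def, smul_smul]
  congr 1
  have h1 : ((n : ℂ) + 1) ≠ 0 := by exact_mod_cast n.succ_ne_zero
  have h2 : (n ! : ℂ) ≠ 0 := by exact_mod_cast n.factorial_ne_zero
  rw [Nat.factorial_succ]
  push_cast
  field_simp

lemma formalDeriv_formalExp (A : R) : formalDeriv (formalExp A) = C A * formalExp A := by
  ext n
  simp only [formalDeriv, formalExp, coeff_mk, coeff_C_mul]
  rw [succ_mul_inv_factorial_smul, pow_succ', mul_smul_comm]

/-- The coefficients of `e^{ct²/2}`. -/
noncomputable def halfSqExpCoeff (c : ℂ) (m : ℕ) : ℂ := if Even m then ((m / 2)! : ℂ)⁻¹ * (c / 2) ^ (m / 2) else 0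

lemma succ_mul_halfSqExpCoeff (c : ℂ) (m : ℕ) :
    ((m : ℂ) + 2) * halfSqExpCoeff c (m + 2) = c * halfSqExpCoeff c m := by
  unfold halfSqExpCoeff
  by_cases h : Even m
  · obtain ⟨k, rfl⟩ := h
    have e1 : (k + k) / 2 = k := by omega
    have e2 : (k + k + 2) / 2 = k + 1 := by omega
    have h1 : ((k : ℂ) + 1) ≠ 0 := by exact_mod_cast k.succ_ne_zero
    have h2 : (k ! : ℂ) ≠ 0 := by exact_mod_cast k.factorial_ne_zero
    rw [if_pos (show Even (k + k + 2) from ⟨k + 1, by ring⟩), if_pos (show Even (k + k) from ⟨k, rfl⟩), e1, e2, Nat.factorial_succ,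
      pow_succ]
    push_cast
    field_simp
    ring
  · rw [if_neg h, if_neg (by simpa [Nat.even_add] using h)]
    simp

lemma hasSum_halfSqExpCoeff (c : ℂ) : HasSum (halfSqExpCoeff c) (Complex.exp (c / 2)) := by
  have hinj : Function.Injective fun k : ℕ => 2 * k := fun a b h => by simpa using h
  rw [← hinj.hasSum_iff]
  · have h := NormedSpace.expSeries_div_hasSum_exp (𝔸 := ℂ) (c / 2)
    rw [← Complex.exp_eq_exp_ℂ] at h
    have e : (halfSqExpCoeff c ∘ fun k => 2 * k) = fun k : ℕ => (c / 2) ^ k / (k ! : ℂ) := by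
      funext k
      simp [halfSqExpCoeff, div_eq_inv_mul]
    rwa [e]
  · intro m hm
    rw [halfSqExpCoeff, if_neg]
    rintro ⟨k, rfl⟩
    exact hm ⟨k, by simp; ring⟩

lemma summable_norm_halfSqExpCoeff (c : ℂ) : Summable fun m => ‖halfSqExpCoeff c m‖ :=
  (hasSum_halfSqExpCoeff c).summable.norm

/-- The formal series `e^{ct²/2}`. -/
noncomputable def formalHalfSqExp (R : Type*) [Ring R] [Algebra ℂ R] (c : ℂ) : PowerSeries R :=
  PowerSeries.mk fun n => algebraMap ℂ R (halfSqExpCoeff c n)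

lemma formalDeriv_formalHalfSqExp (c : ℂ) :
    formalDeriv (formalHalfSqExp R c) = (c • X) * formalHalfSqExp R c := by
  have hs : ∀ (N : ℕ) (H : PowerSeries R), coeff N (c • H) = c • coeff N H := fun _ H => rfl
  ext n
  rw [smul_mul_assoc, hs]
  rcases n with _ | n
  · simp [formalDeriv, formalHalfSqExp, halfSqExpCoeff]
  · rw [coeff_succ_X_mul]
    simp only [formalDeriv, formalHalfSqExp, coeff_mk]
    have := congrArg (algebraMap ℂ R) (succ_mul_halfSqExpCoeff c n)
    rw [Algebra.smul_def, ← map_mul, ← this]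
    simp only [map_mul, map_add, map_natCast, map_ofNat]
    push_cast
    congr 1
    rw [add_assoc, one_add_one_eq_two]

lemma pow_mul_of_commutator {A B : R} {c : ℂ} (h : A * B = B * A + algebraMap ℂ R c) (n : ℕ) :
    A ^ (n + 1) * B = B * A ^ (n + 1) + c • (((n : R) + 1) * A ^ n) := by
  induction n with
  | zero => simp [h, Algebra.smul_def]
  | succ n ih =>
    rw [pow_succ', mul_assoc, ih, mul_add, ← mul_assoc, h, add_mul, mul_assoc, ← pow_succ',
      Algebra.smul_def, Algebra.smul_def, add_assoc]
    congr 1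
    rw [← mul_assoc A, ← Algebra.commutes c A, mul_assoc (algebraMap ℂ R c), ← mul_add]
    congr 1
    rw [← mul_assoc, ← ((Nat.cast_commute n A).add_left (Commute.one_left _)).eq, mul_assoc,
      ← pow_succ']
    push_cast
    noncomm_ring

/-- The Baker–Campbell–Hausdorff formula for a central commutator, as an identity of formal
power series. -/
lemma formalExp_mul_formalExp {A B : R} {c : ℂ} (h : A * B = B * A + algebraMap ℂ R c) :
    formalExp A * formalExp B = formalHalfSqExp R c * formalExp (A + B) := by
  have hs : ∀ (N : ℕ) (H : PowerSeries R), coeff N (c • H) = c • coeff N H := fun _ H => rfl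
  -- This is e^{tA} B = (B + ct) e^{tA}: moving B through e^{tA} costs ct.
  have hc : formalExp A * C B = (C B + c • X) * formalExp A := by
    ext n
    rw [coeff_mul_C, add_mul, map_add, coeff_C_mul, smul_mul_assoc, hs]
    rcases n with _ | n
    · simp [formalExp]
    · rw [coeff_succ_X_mul]
      simp only [formalExp, coeff_mk]
      rw [smul_mul_assoc, pow_mul_of_commutator h, smul_add, mul_smul_comm]
      congr 1
      rw [smul_comm, ← succ_mul_inv_factorial_smul n, mul_smul_comm]
  have hcomm : formalHalfSqExp R c * C (A + B) = C (A + B) * formalHalfSqExp R c := by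
    ext n
    rw [coeff_mul_C, coeff_C_mul]
    simp only [formalHalfSqExp, coeff_mk]
    exact Algebra.commutes _ _
  -- Both sides solve F' = (A + B + ct)F with constant term 1.
  refine eq_of_formalDeriv_eq (A := A + B) (c := c) ?_ ?_ ?_
  · rw [formalDeriv_mul, formalDeriv_formalExp, formalDeriv_formalExp, ← mul_assoc (formalExp A), hc,
      map_add]
    noncomm_ring
  · rw [formalDeriv_mul, formalDeriv_formalExp, formalDeriv_formalHalfSqExp, ← mul_assoc, hcomm]
    noncomm_ring
  · simp [formalExp, formalHalfSqExp, halfSqExpCoeff]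

end PowerSeriesODE

/-! ### Growth estimates for the exponential series -/

/-- The growth bound `∏_{i<m} c √(n+i+1)` for words of length `m` in ladder operators. -/
noncomputable def ladderBound (c : ℝ) (n m : ℕ) : ℝ :=
  ∏ j ∈ Finset.range m, (c * √((n + j + 1 : ℕ) : ℝ))

lemma ladderBound_nonneg {c : ℝ} (hc : 0 ≤ c) (n m : ℕ) : 0 ≤ ladderBound c n m :=
  Finset.prod_nonneg fun _ _ => by positivity

lemma ladderBound_mul (a c : ℝ) (n m : ℕ) : ladderBound (a * c) n m = a ^ m * ladderBound c n m := by
  simp only [ladderBound, mul_assoc, Finset.prod_mul_distrib, Finset.prod_const, Finset.card_range]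

/-- Ratio test: consecutive terms have ratio c√(n+k+1)/(k+1), which tends to 0. -/
lemma summable_ladderBound {c : ℝ} (hc0 : 0 < c) (n : ℕ) :
    Summable fun k : ℕ => ((k ! : ℝ))⁻¹ * ladderBound c n k := by
  have hb0 : ∀ k, 0 < ladderBound c n k := fun k =>
    Finset.prod_pos fun j _ => mul_pos hc0 (Real.sqrt_pos.2 (by positivity))
  refine summable_of_ratio_test_tendsto_lt_one (l := 0) one_pos
    (Filter.Eventually.of_forall fun k => (mul_pos (by positivity) (hb0 k)).ne') ?_
  have hr : ∀ k, ‖(((k + 1)! : ℝ))⁻¹ * ladderBound c n (k + 1)‖ / ‖((k ! : ℝ))⁻¹ * ladderBound c n k‖ =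
      c * √((n + k + 1 : ℕ) : ℝ) / (k + 1) := by
    intro k
    rw [Real.norm_of_nonneg (mul_pos (by positivity) (hb0 _)).le,
      Real.norm_of_nonneg (mul_pos (by positivity) (hb0 _)).le]
    have hp := hb0 k
    rw [ladderBound, Finset.prod_range_succ, ← ladderBound, Nat.factorial_succ]
    push_cast
    field_simp
  simp_rw [hr]
  have hle : ∀ k : ℕ, c * √((n + k + 1 : ℕ) : ℝ) / (k + 1) ≤
      c * √(n + 1 : ℝ) * √(1 / ((k : ℝ) + 1)) := by
    intro k
    have h1 : √((n + k + 1 : ℕ) : ℝ) ≤ √(n + 1 : ℝ) * √((k : ℝ) + 1) := by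
      rw [← Real.sqrt_mul (by positivity)]
      apply Real.sqrt_le_sqrt
      push_cast
      nlinarith [mul_nonneg (Nat.cast_nonneg (α := ℝ) n) (Nat.cast_nonneg (α := ℝ) k)]
    have h2 : √(1 / ((k : ℝ) + 1)) = √((k : ℝ) + 1) / (k + 1) := by
      rw [Real.sqrt_div_self', Real.sqrt_div zero_le_one, Real.sqrt_one]
    rw [h2]
    calc _ ≤ c * (√(n + 1 : ℝ) * √((k : ℝ) + 1)) / (k + 1) := by gcongr
      _ = _ := by ring
  refine squeeze_zero (fun k => by positivity) hle ?_
  have h0 : Filter.Tendsto (fun k : ℕ => √(1 / ((k : ℝ) + 1))) Filter.atTop (nhds 0) := by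
    have := (Real.continuous_sqrt.tendsto 0).comp
      (tendsto_one_div_add_atTop_nhds_zero_nat (𝕜 := ℝ))
    simpa [Function.comp_def] using this
  simpa using h0.const_mul (c * √(n + 1 : ℝ))

/-- Raising and lowering each cost at most ‖ξ‖√(n+1), whence the 2‖ξ‖; the lowered state is covered
by monotonicity of the bound in n. The map `L` is arbitrary so that words mixing two different
generators can be estimated. -/
lemma norm_dispGen_single_le {L : (ℕ →₀ ℂ) →ₗ[ℂ] Fock} {c : ℝ} {m : ℕ} {ξ : ℂ} (hξ : 2 * ‖ξ‖ ≤ c)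
    (hL : ∀ n, ‖L (Finsupp.single n 1)‖ ≤ ladderBound c n m) (n : ℕ) :
    ‖L (dispGen ξ (Finsupp.single n 1))‖ ≤ ladderBound c n (m + 1) := by
  have hc : 0 ≤ c := by linarith [norm_nonneg ξ]
  rw [dispGen_single, map_sub, map_smul, map_smul]
  have e : ladderBound c n (m + 1) = ladderBound c (n + 1) m * (c * √(n + 1 : ℝ)) := by
    rw [ladderBound, Finset.prod_range_succ', ladderBound]
    simp only [add_zero, Nat.cast_add, Nat.cast_one]
    congr 1
    refine Finset.prod_congr rfl fun j _ => ?_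
    rw [show (n : ℝ) + (j + 1) + 1 = n + 1 + j + 1 by ring]
  have h1 := hL (n + 1)
  have h2 : ‖L (Finsupp.single (n - 1) 1)‖ ≤ ladderBound c (n + 1) m := by
    refine (hL (n - 1)).trans ?_
    unfold ladderBound
    gcongr
    omega
  have hP0 := ladderBound_nonneg hc (n + 1) m
  have hs : √(n : ℝ) ≤ √(n + 1 : ℝ) := Real.sqrt_le_sqrt (by linarith)
  rw [e]
  refine (norm_sub_le _ _).trans ?_
  rw [norm_smul, norm_smul, norm_mul, norm_mul, Complex.norm_real, Complex.norm_real,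
    RCLike.norm_conj, Real.norm_of_nonneg (Real.sqrt_nonneg _),
    Real.norm_of_nonneg (Real.sqrt_nonneg _)]
  calc _ ≤ ‖ξ‖ * √(n + 1 : ℝ) * ladderBound c (n + 1) m + ‖ξ‖ * √(n + 1 : ℝ) * ladderBound c (n + 1) m := by
        gcongr
    _ = 2 * ‖ξ‖ * (ladderBound c (n + 1) m * √(n + 1 : ℝ)) := by ring
    _ ≤ c * (ladderBound c (n + 1) m * √(n + 1 : ℝ)) := by gcongr
    _ = _ := by ring

lemma norm_comp_dispGen_pow_le {L : (ℕ →₀ ℂ) →ₗ[ℂ] Fock} {c : ℝ} {m : ℕ} {ξ : ℂ}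
    (hξ : 2 * ‖ξ‖ ≤ c) (hL : ∀ n, ‖L (Finsupp.single n 1)‖ ≤ ladderBound c n m) (k n : ℕ) :
    ‖L ((dispGen ξ ^ k) (Finsupp.single n 1))‖ ≤ ladderBound c n (m + k) := by
  induction k generalizing n with
  | zero => simpa using hL n
  | succ k ih =>
    rw [pow_succ, Module.End.mul_apply]
    exact norm_dispGen_single_le (L := L ∘ₗ (dispGen ξ ^ k)) hξ ih n

lemma norm_toFock_single_le (c : ℝ) (n : ℕ) : ‖toFock (Finsupp.single n 1)‖ ≤ ladderBound c n 0 := by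
  simp [toFock_single, norm_numberState, ladderBound]

lemma norm_expTerm_le {c : ℝ} {ξ : ℂ} (hξ : 2 * ‖ξ‖ ≤ c) (n k : ℕ) :
    ‖expTerm ξ n k‖ ≤ ((k ! : ℝ))⁻¹ * ladderBound c n k := by
  rw [expTerm, norm_smul, norm_inv, Complex.norm_natCast]
  gcongr
  simpa using norm_comp_dispGen_pow_le hξ (norm_toFock_single_le c) k n

lemma continuous_expTerm (n k : ℕ) : Continuous fun ξ => expTerm ξ n k := by
  have : ∀ n, Continuous fun ξ => toFock ((dispGen ξ ^ k) (Finsupp.single n 1)) := by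
    induction k with
    | zero => intro n; simpa using continuous_const
    | succ k ih =>
      intro n
      simp_rw [pow_succ, Module.End.mul_apply, dispGen_single, map_sub, map_smul]
      exact (((continuous_id.mul continuous_const).smul (ih _))).sub
        ((Complex.continuous_conj.mul continuous_const).smul (ih _))
  exact (continuous_const (y := ((k ! : ℂ))⁻¹)).smul (this n)

lemma continuous_displaced (n : ℕ) : Continuous fun ξ => displaced ξ n := by
  rw [continuous_iff_continuousAt]
  intro ξ₀
  have : ContinuousOn (fun ξ => displaced ξ n) (Metric.ball 0 (‖ξ₀‖ + 1)) := by
    refine continuousOn_tsum (u := fun k => ((k ! : ℝ))⁻¹ * ladderBound (2 * (‖ξ₀‖ + 1)) n k)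
      (fun k => (continuous_expTerm n k).continuousOn) (summable_ladderBound (by positivity) n) ?_
    intro k ξ hξ
    refine norm_expTerm_le ?_ n k
    have : ‖ξ‖ < ‖ξ₀‖ + 1 := by simpa using hξ
    linarith
  exact this.continuousAt (Metric.isOpen_ball.mem_nhds (by simp))

/-! ### Strong continuity of the displacement operators -/

lemma norm_displacement_apply (ξ : ℂ) (x : Fock) : ‖displacement ξ x‖ = ‖x‖ :=
  LinearIsometry.norm_map _ x

/-- The number states, as a Hilbert basis of `Fock`. -/
noncomputable def numberBasis : HilbertBasis ℕ ℂ Fock := ⟨LinearIsometryEquiv.refl ℂ _⟩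

lemma numberBasis_apply (n : ℕ) : numberBasis n = numberState n := by
  rw [← HilbertBasis.repr_symm_single]
  rfl

lemma ext_numberState {A B : Fock →L[ℂ] Fock} (h : ∀ n, A (numberState n) = B (numberState n)) :
    A = B := by
  refine ContinuousLinearMap.ext_on (s := Set.range numberBasis) ?_ ?_
  · have := numberBasis.dense_span
    rwa [← Submodule.dense_iff_topologicalClosure_eq_top] at this
  · rintro _ ⟨n, rfl⟩
    rw [numberBasis_apply, h]

/-- Continuity on finite combinations of number states extends to all vectors by density, since
every D(ξ) is isometric (an ε/3 argument). -/
lemma continuous_displacement_apply (x : Fock) : Continuous fun ξ => displacement ξ x := by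
  have hd : Dense (Submodule.span ℂ (Set.range numberBasis) : Set Fock) := by
    have := numberBasis.dense_span
    rwa [← Submodule.dense_iff_topologicalClosure_eq_top] at this
  have h0 : ∀ y ∈ Submodule.span ℂ (Set.range numberBasis),
      Continuous fun ξ => displacement ξ y := by
    intro y hy
    induction hy using Submodule.span_induction with
    | mem y hy =>
      obtain ⟨n, rfl⟩ := hy
      simp_rw [numberBasis_apply, displacement_numberState]
      exact continuous_displaced n
    | zero => simpa using continuous_const
    | add y z _ _ hy hz => simp_rw [map_add]; exact hy.add hz
    | smul c y _ hy => simp_rw [map_smul]; exact (continuous_const (y := c)).smul hy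
  rw [Metric.continuous_iff]
  intro ξ ε hε
  obtain ⟨y, hy, hxy⟩ := Metric.dense_iff.1 hd x (ε / 3) (by positivity)
  obtain ⟨δ, hδ, h⟩ := Metric.continuous_iff.1 (h0 y hxy) ξ (ε / 3) (by positivity)
  refine ⟨δ, hδ, fun η hη => ?_⟩
  have hyx : ‖x - y‖ < ε / 3 := by rw [← dist_eq_norm, dist_comm]; exact hy
  have h3 := h η hη
  rw [dist_eq_norm] at h3 ⊢
  have e : displacement η x - displacement ξ x = displacement η (x - y) +
      (displacement η y - displacement ξ y) - displacement ξ (x - y) := by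
    simp only [map_sub]; abel
  rw [e]
  calc _ ≤ ‖displacement η (x - y)‖ + ‖displacement η y - displacement ξ y‖ +
      ‖displacement ξ (x - y)‖ := (norm_sub_le _ _).trans (by gcongr; exact norm_add_le _ _)
    _ < ε := by rw [norm_displacement_apply, norm_displacement_apply]; linarith

lemma continuous_displacement_comp {X : Type*} [TopologicalSpace X] {f : X → ℂ} {g : X → Fock}
    (hf : Continuous f) (hg : Continuous g) : Continuous fun t => displacement (f t) (g t) := by
  rw [continuous_iff_continuousAt]
  intro t
  have h1 := (((continuous_displacement_apply (g t)).comp hf).tendsto t)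
  have h2 : Filter.Tendsto (fun s => displacement (f s) (g s - g t)) (nhds t) (nhds 0) := by
    rw [tendsto_zero_iff_norm_tendsto_zero]
    simp_rw [norm_displacement_apply]
    have := ((hg.sub continuous_const).norm (E := Fock)).tendsto (f := fun s => ‖g s - g t‖) t
    simpa using this
  have := h2.add h1
  simpa [ContinuousAt] using this

/-! ### The Weyl relation and unitarity -/

/-- On finite combinations of number states the displacement operator is the sum of the
exponential series. -/
lemma hasSum_displacement_toFock (ξ : ℂ) (v : ℕ →₀ ℂ) :
    HasSum (fun k : ℕ => ((k ! : ℂ))⁻¹ • toFock ((dispGen ξ ^ k) v)) (displacement ξ (toFock v)) := by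
  induction v using Finsupp.induction_linear with
  | zero => simp [hasSum_zero]
  | add u v hu hv => simpa only [map_add, smul_add] using hu.add hv
  | single n z =>
    have hz : (Finsupp.single n z : ℕ →₀ ℂ) = z • Finsupp.single n 1 := by simp
    have := (hasSum_displaced ξ n).const_smul z
    rw [hz]
    simp only [map_smul, toFock_single, one_smul, displacement_numberState]
    simpa only [expTerm, smul_comm z] using this

lemma dispGen_add (ξ η : ℂ) : dispGen (ξ + η) = dispGen ξ + dispGen η := by
  simp only [dispGen, map_add, add_smul]
  abel

lemma dispGen_commutator (ξ η : ℂ) : dispGen ξ * dispGen η =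
    dispGen η * dispGen ξ + algebraMap ℂ (Module.End ℂ (ℕ →₀ ℂ)) (ξ * conj η - conj ξ * η) := by
  refine Finsupp.lhom_ext' fun n => LinearMap.ext_ring ?_
  have hs : ((√(n : ℝ) : ℝ) : ℂ) * ((√(n : ℝ) : ℝ) : ℂ) = n := by
    rw [← Complex.ofReal_mul, Real.mul_self_sqrt (by positivity)]; simp
  have hs' : ((√(n + 1 : ℝ) : ℝ) : ℂ) * ((√(n + 1 : ℝ) : ℝ) : ℂ) = n + 1 := by
    rw [← Complex.ofReal_mul, Real.mul_self_sqrt (by positivity)]; simp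
  rw [LinearMap.comp_apply, LinearMap.comp_apply, LinearMap.add_apply, Module.algebraMap_end_apply]
  generalize hz : ξ * conj η - conj ξ * η = z
  simp only [Finsupp.lsingle_apply, Module.End.mul_apply, dispGen_single, map_sub, map_smul]
  ext m
  simp only [Finsupp.coe_sub, Finsupp.coe_add, Finsupp.coe_smul, Pi.sub_apply, Pi.add_apply,
    Pi.smul_apply, smul_eq_mul]
  -- At n = 0 the truncated n - 1 is harmless because the lowering coefficient √0 vanishes, but it
  -- must be treated apart.
  rcases n with _ | n
  · simp only [Nat.cast_zero, Real.sqrt_zero, Complex.ofReal_zero, mul_zero, zero_mul, sub_zero,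
      zero_add, Nat.cast_one] at hs' ⊢
    rw [← hz]
    linear_combination (Finsupp.single 0 1 : ℕ →₀ ℂ) m * (ξ * conj η - conj ξ * η) * hs'
  · push_cast at hs hs' ⊢
    rw [← hz]
    linear_combination (Finsupp.single (n + 1) 1 : ℕ →₀ ℂ) m * (ξ * conj η - conj ξ * η) * (hs' - hs)

/-- The Weyl relation. -/
lemma displacement_mul (ξ η : ℂ) : displacement ξ ∘L displacement η =
    Complex.exp ((ξ * conj η - conj ξ * η) / 2) • displacement (ξ + η) := by
  refine ext_numberState fun n => ?_
  set A := dispGen ξ with hA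
  set B := dispGen η with hB
  set c := ξ * conj η - conj ξ * η with hc
  set M := 2 * (‖ξ‖ + ‖η‖ + 1) with hM
  have hMξ : 2 * ‖ξ‖ ≤ M := by rw [hM]; linarith [norm_nonneg η]
  have hMη : 2 * ‖η‖ ≤ M := by rw [hM]; linarith [norm_nonneg ξ]
  have hM0 : 0 < M := by positivity
  let F : ℕ × ℕ → Fock := fun p =>
    ((p.1 ! : ℂ)⁻¹ * (p.2 ! : ℂ)⁻¹) • toFock ((A ^ p.1) ((B ^ p.2) (Finsupp.single n 1)))
  have hFn : ∀ p, ‖F p‖ ≤ ((p.1 ! : ℝ)⁻¹ * (p.2 ! : ℝ)⁻¹) * ladderBound M n (p.1 + p.2) := by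
    intro p
    simp only [F]
    rw [norm_smul, norm_mul, norm_inv, norm_inv, Complex.norm_natCast, Complex.norm_natCast]
    gcongr
    refine norm_comp_dispGen_pow_le (L := toFock ∘ₗ A ^ p.1) hMη (fun m => ?_) p.2 n
    simpa using norm_comp_dispGen_pow_le hMξ (norm_toFock_single_le M) p.1 m
  have hF : Summable F := by
    refine Summable.of_norm_bounded (g := fun p : ℕ × ℕ =>
      ((p.1 ! : ℝ)⁻¹ * (p.2 ! : ℝ)⁻¹) * ladderBound M n (p.1 + p.2)) ?_ hFn
    -- Along j + k = N the weights 1/(j! k!) add up to 2^N/N!; the factor 2^N is absorbed by passing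
    -- from M to 2M.
    rw [← (Finset.HasAntidiagonal.sigmaAntidiagonalEquivProd (A := ℕ)).summable_iff,
      summable_sigma_of_nonneg]
    · refine ⟨fun N => Summable.of_finite, ?_⟩
      refine (summable_ladderBound (c := 2 * M) (by positivity) n).congr fun N => ?_
      rw [tsum_fintype]
      have h1 := Finset.sum_coe_sort (Finset.HasAntidiagonal.antidiagonal N)
        fun p : ℕ × ℕ => ((p.1 ! : ℝ)⁻¹ * (p.2 ! : ℝ)⁻¹) * ladderBound M n (p.1 + p.2)
      refine Eq.trans ?_ h1.symm
      rw [ladderBound_mul]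
      have h2 : ∀ p ∈ Finset.HasAntidiagonal.antidiagonal N,
          ((p.1 ! : ℝ)⁻¹ * (p.2 ! : ℝ)⁻¹) * ladderBound M n (p.1 + p.2) =
          ((N ! : ℝ)⁻¹ * ladderBound M n N) * (N.choose p.1 : ℝ) := by
        intro p hp
        have hp' := Finset.HasAntidiagonal.mem_antidiagonal.1 hp
        have hf : ((N.choose p.1 : ℕ) : ℝ) = (N ! : ℝ) / ((p.1 ! : ℝ) * (p.2 ! : ℝ)) := by
          rw [← hp', Nat.choose_symm_add, Nat.add_choose,
            Nat.cast_div (Nat.factorial_mul_factorial_dvd_factorial_add _ _)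
            (by exact_mod_cast (Nat.mul_pos (Nat.factorial_pos _) (Nat.factorial_pos _)).ne'),
            Nat.cast_mul]
        have hN : (N ! : ℝ) ≠ 0 := by exact_mod_cast N.factorial_ne_zero
        rw [hp', hf]
        field_simp
      rw [Finset.sum_congr rfl h2, ← Finset.mul_sum]
      have h3 : ∑ p ∈ Finset.HasAntidiagonal.antidiagonal N, (N.choose p.1 : ℝ) = 2 ^ N := by
        rw [Finset.Nat.sum_antidiagonal_eq_sum_range_succ_mk]
        exact_mod_cast Nat.sum_range_choose N
      rw [h3]
      ring
    · intro p
      exact mul_nonneg (by positivity) (ladderBound_nonneg hM0.le _ _)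
  have hleft : displacement ξ (displacement η (numberState n)) = ∑' p, F p := by
    have h1 : numberState n = toFock (Finsupp.single n 1) := by simp [toFock_single]
    have h2 := (hasSum_displacement_toFock η (Finsupp.single n 1)).mapL (displacement ξ)
    have h3 : ∀ k, HasSum (fun j => F (j, k))
        (displacement ξ ((k ! : ℂ)⁻¹ • toFock ((B ^ k) (Finsupp.single n 1)))) := by
      intro k
      have := (hasSum_displacement_toFock ξ ((B ^ k) (Finsupp.single n 1))).const_smul ((k ! : ℂ)⁻¹)
      rw [map_smul]
      simpa only [smul_smul, mul_comm, F] using this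
    have h4 : Summable (F ∘ (Equiv.prodComm ℕ ℕ)) := (Equiv.summable_iff _).2 hF
    have h5 := h4.hasSum.prod_fiberwise (g := fun k =>
      displacement ξ ((k ! : ℂ)⁻¹ • toFock ((B ^ k) (Finsupp.single n 1)))) h3
    rw [h1, h2.unique h5]
    exact (Equiv.prodComm ℕ ℕ).tsum_eq F
  let G : ℕ × ℕ → Fock := fun p => halfSqExpCoeff c p.1 • expTerm (ξ + η) n p.2
  have hG : Summable G := by
    refine Summable.of_norm_bounded ((summable_norm_halfSqExpCoeff c).mul_of_nonneg
      (summable_norm_expTerm (ξ + η) n) (fun _ => norm_nonneg _) fun _ => norm_nonneg _) fun p => ?_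
    exact norm_smul_le _ _
  have hright : Complex.exp (c / 2) • displaced (ξ + η) n = ∑' p, G p := by
    have h2 : ∀ m, HasSum (fun k => G (m, k)) (halfSqExpCoeff c m • displaced (ξ + η) n) :=
      fun m => (hasSum_displaced _ n).const_smul _
    exact ((hasSum_halfSqExpCoeff c).smul_const _).unique (hG.hasSum.prod_fiberwise h2)
  have hdiag : ∀ H : ℕ × ℕ → Fock, Summable H → ∑' p, H p =
      ∑' N, ∑ p ∈ Finset.HasAntidiagonal.antidiagonal N, H p := by
    intro H hH
    rw [← (Finset.HasAntidiagonal.sigmaAntidiagonalEquivProd (A := ℕ)).tsum_eq H]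
    have hs' := (Finset.HasAntidiagonal.sigmaAntidiagonalEquivProd (A := ℕ)).summable_iff.2 hH
    refine hs'.tsum_sigma.trans (tsum_congr fun N => ?_)
    rw [tsum_fintype]
    exact Finset.sum_coe_sort (Finset.HasAntidiagonal.antidiagonal N) fun p => H p
  rw [ContinuousLinearMap.comp_apply, hleft, _root_.smul_apply,
    displacement_numberState, hright, hdiag F hF, hdiag G hG]
  refine tsum_congr fun N => ?_
  -- With both double series grouped by total degree, the parts of degree N are the coefficients of
  -- t^N in the formal identity, applied to |n⟩.
  have hBCH := congrArg
    (fun S : PowerSeries (Module.End ℂ (ℕ →₀ ℂ)) => toFock (PowerSeries.coeff N S (Finsupp.single n 1)))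
    (formalExp_mul_formalExp (R := Module.End ℂ (ℕ →₀ ℂ)) (dispGen_commutator ξ η))
  simp only [PowerSeries.coeff_mul, formalExp, formalHalfSqExp, PowerSeries.coeff_mk,
    LinearMap.sum_apply, map_sum] at hBCH
  refine Eq.trans (Finset.sum_congr rfl fun p _ => ?_)
    (hBCH.trans (Finset.sum_congr rfl fun p _ => ?_))
  · simp only [F, Module.End.mul_apply, LinearMap.smul_apply, map_smul, smul_smul]
    rw [mul_comm]
  · simp only [G, Module.End.mul_apply, Module.algebraMap_end_apply, LinearMap.smul_apply, map_smul,
      expTerm, dispGen_add]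
    rw [smul_comm]

lemma displacement_zero : displacement 0 = ContinuousLinearMap.id ℂ Fock := by
  refine ext_numberState fun n => ?_
  have h : dispGen 0 = 0 := by ext; simp [dispGen]
  rw [displacement_numberState]
  refine (hasSum_displaced 0 n).unique ?_
  convert hasSum_single (f := expTerm 0 n) 0 ?_ using 1
  · simp [expTerm, toFock_single]
  · intro k hk
    simp [expTerm, h, hk]

lemma displacement_neg_apply (ξ : ℂ) (x : Fock) : displacement (-ξ) (displacement ξ x) = x := by
  have h := congrArg (· x) (displacement_mul (-ξ) ξ)
  simp only [map_neg, neg_add_cancel, displacement_zero] at h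
  simpa [mul_comm] using h

lemma displacement_apply_neg (ξ : ℂ) (x : Fock) : displacement ξ (displacement (-ξ) x) = x := by
  simpa using displacement_neg_apply (-ξ) x

lemma adjoint_displacement (ξ : ℂ) :
    ContinuousLinearMap.adjoint (displacement ξ) = displacement (-ξ) := by
  symm
  rw [ContinuousLinearMap.eq_adjoint_iff]
  intro x y
  have : ⟪displacement ξ (displacement (-ξ) x), displacement ξ y⟫_ℂ = ⟪displacement (-ξ) x, y⟫_ℂ :=
    LinearIsometry.inner_map_map _ _ _
  rw [← this, displacement_apply_neg]

/-- The displacement operator as a unitary equivalence. -/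
noncomputable def displacementEquiv (ξ : ℂ) : Fock ≃ₗᵢ[ℂ] Fock where
  toFun := displacement ξ
  invFun := displacement (-ξ)
  map_add' := map_add _
  map_smul' := map_smul _
  left_inv := displacement_neg_apply ξ
  right_inv := displacement_apply_neg ξ
  norm_map' := norm_displacement_apply ξ

/-- The two Weyl phases add up instead of cancelling. This relation turns averaging over
displacements into multiplication of characteristic functions. -/
lemma displacement_conj (α ξ : ℂ) : displacement (-α) ∘L displacement ξ ∘L displacement α =
    fourierKernel ξ α • displacement ξ := by
  rw [displacement_mul, ContinuousLinearMap.comp_smul, displacement_mul, smul_smul, ← Complex.exp_add,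
    neg_add_cancel_comm_assoc, fourierKernel]
  congr 2
  simp only [map_add, map_neg]
  ring

open scoped ENNReal NNReal

/-! ### Hilbert–Schmidt operators and basis independence -/

section HilbertSchmidt

variable {H : Type*} [NormedAddCommGroup H] [InnerProductSpace ℂ H]


lemma HilbertBasis.hasSum_norm_inner_sq (f : HilbertBasis ℕ ℂ H) (x : H) :
    HasSum (fun m => ‖⟪f m, x⟫_ℂ‖ ^ 2) (‖x‖ ^ 2) := by
  have h := Complex.hasSum_re (f.hasSum_inner_mul_inner x x)
  convert h using 1
  · funext m
    rw [← inner_conj_symm x (f m), mul_comm, Complex.mul_conj, Complex.normSq_eq_norm_sq]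
    simp only [Complex.ofReal_re]
  · rw [inner_self_eq_norm_sq_to_K]
    norm_cast

lemma HilbertBasis.tsum_enorm_inner_sq (f : HilbertBasis ℕ ℂ H) (x : H) :
    ∑' m, ‖⟪f m, x⟫_ℂ‖ₑ ^ 2 = ‖x‖ₑ ^ 2 := by
  have h := f.hasSum_norm_inner_sq x
  have e : ∀ z : ℝ, ENNReal.ofReal (‖z‖ ^ 2) = ‖z‖ₑ ^ 2 := fun z => by
    rw [ENNReal.ofReal_pow (norm_nonneg _), ofReal_norm]
  have h2 := ENNReal.ofReal_tsum_of_nonneg (f := fun m => ‖⟪f m, x⟫_ℂ‖ ^ 2)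
    (fun _ => by positivity) h.summable
  rw [h.tsum_eq, ENNReal.ofReal_pow (norm_nonneg _), ofReal_norm] at h2
  rw [h2]
  refine tsum_congr fun m => ?_
  rw [ENNReal.ofReal_pow (norm_nonneg _), ofReal_norm]

lemma summable_norm_sq_iff {E : Type*} [NormedAddCommGroup E] (a : ℕ → E) :
    (Summable fun n => ‖a n‖ ^ 2) ↔ ∑' n, ‖a n‖ₑ ^ 2 ≠ ∞ := by
  have e : (fun n => ‖a n‖ₑ ^ 2) = fun n => ((‖a n‖₊ ^ 2 : ℝ≥0) : ℝ≥0∞) := by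
    funext n
    rw [ENNReal.coe_pow]; rfl
  rw [e, ENNReal.tsum_coe_ne_top_iff_summable, ← NNReal.summable_coe]
  simp

variable [CompleteSpace H]

/-- The Hilbert–Schmidt norm does not depend on the basis. -/
lemma tsum_enorm_sq_adjoint (e f : HilbertBasis ℕ ℂ H) (A : H →L[ℂ] H) :
    ∑' n, ‖A (e n)‖ₑ ^ 2 = ∑' m, ‖ContinuousLinearMap.adjoint A (f m)‖ₑ ^ 2 := by
  simp_rw [← f.tsum_enorm_inner_sq (A _), ← e.tsum_enorm_inner_sq (ContinuousLinearMap.adjoint A _)]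
  rw [ENNReal.tsum_comm]
  refine tsum_congr fun m => tsum_congr fun n => ?_
  rw [ContinuousLinearMap.adjoint_inner_right, ← inner_conj_symm (f m), ← ofReal_norm, ← ofReal_norm,
    RCLike.norm_conj]

lemma summable_norm_sq_adjoint {e : HilbertBasis ℕ ℂ H} {A : H →L[ℂ] H}
    (h : Summable fun n => ‖A (e n)‖ ^ 2) (f : HilbertBasis ℕ ℂ H) :
    Summable fun m => ‖ContinuousLinearMap.adjoint A (f m)‖ ^ 2 := by
  rw [summable_norm_sq_iff] at h ⊢
  rwa [← tsum_enorm_sq_adjoint e f A]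

/-- The Hilbert–Schmidt pairing does not depend on the basis. -/
lemma exists_hasSum_inner_adjoint {e : HilbertBasis ℕ ℂ H} {A B : H →L[ℂ] H}
    (hA : Summable fun n => ‖A (e n)‖ ^ 2) (hB : Summable fun n => ‖B (e n)‖ ^ 2)
    (f : HilbertBasis ℕ ℂ H) :
    ∃ S, HasSum (fun n => ⟪A (e n), B (e n)⟫_ℂ) S ∧
      HasSum (fun m => ⟪ContinuousLinearMap.adjoint B (f m),
        ContinuousLinearMap.adjoint A (f m)⟫_ℂ) S := by
  let F : ℕ × ℕ → ℂ := fun p => ⟪A (e p.1), f p.2⟫_ℂ * ⟪f p.2, B (e p.1)⟫_ℂ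
  have hsum : ∀ {T : H →L[ℂ] H}, (Summable fun n => ‖T (e n)‖ ^ 2) →
      Summable fun p : ℕ × ℕ => ‖⟪f p.2, T (e p.1)⟫_ℂ‖ ^ 2 := by
    intro T hT
    refine (summable_prod_of_nonneg fun p => sq_nonneg _).2
      ⟨fun n => (f.hasSum_norm_inner_sq (T (e n))).summable, ?_⟩
    have h1 : ∀ n, ∑' m, ‖⟪f m, T (e n)⟫_ℂ‖ ^ 2 = ‖T (e n)‖ ^ 2 := fun n =>
      (f.hasSum_norm_inner_sq (T (e n))).tsum_eq
    exact hT.congr fun n => (h1 n).symm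
  have hF : Summable F := by
    refine Summable.of_norm_bounded
      (g := fun p : ℕ × ℕ => ‖⟪f p.2, A (e p.1)⟫_ℂ‖ ^ 2 + ‖⟪f p.2, B (e p.1)⟫_ℂ‖ ^ 2)
      ((hsum hA).add (hsum hB)) fun p => ?_
    change ‖⟪A (e p.1), f p.2⟫_ℂ * ⟪f p.2, B (e p.1)⟫_ℂ‖ ≤ _
    rw [norm_mul, norm_inner_symm (A (e p.1))]
    nlinarith [sq_nonneg (‖⟪f p.2, A (e p.1)⟫_ℂ‖ - ‖⟪f p.2, B (e p.1)⟫_ℂ‖),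
      sq_nonneg (‖⟪f p.2, A (e p.1)⟫_ℂ‖), sq_nonneg ‖⟪f p.2, B (e p.1)⟫_ℂ‖]
  refine ⟨∑' p, F p, hF.hasSum.prod_fiberwise fun n =>
    f.hasSum_inner_mul_inner (A (e n)) (B (e n)), ?_⟩
  have h4 : HasSum (F ∘ (Equiv.prodComm ℕ ℕ)) (∑' p, F p) := (Equiv.hasSum_iff _).2 hF.hasSum
  refine h4.prod_fiberwise fun m => ?_
  have := e.hasSum_inner_mul_inner (ContinuousLinearMap.adjoint B (f m))
    (ContinuousLinearMap.adjoint A (f m))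
  simp only [ContinuousLinearMap.adjoint_inner_left, ContinuousLinearMap.adjoint_inner_right] at this ⊢
  rw [funext fun n => mul_comm (⟪f m, B (e n)⟫_ℂ) (⟪A (e n), f m⟫_ℂ)] at this
  exact this

lemma ContinuousLinearMap.IsPositive.exists_sqrt {P : H →L[ℂ] H} (hP : P.IsPositive) :
    ∃ s : H →L[ℂ] H, ContinuousLinearMap.adjoint s = s ∧ P = s ∘L s := by
  have h' : 0 ≤ P := (ContinuousLinearMap.nonneg_iff_isPositive P).2 hP
  exact ⟨CFC.sqrt P, (IsSelfAdjoint.of_nonneg (CFC.sqrt_nonneg P)).adjoint_eq,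
    (CFC.sqrt_mul_sqrt_self P).symm⟩

variable {s X : H →L[ℂ] H} {e : HilbertBasis ℕ ℂ H}

/-- The adjoint X†s is Hilbert–Schmidt since ‖X†s e‖ ≤ ‖X†‖‖s e‖, and taking adjoints preserves the
Hilbert–Schmidt norm. -/
lemma summable_norm_sq_comp (hs : ContinuousLinearMap.adjoint s = s)
    (h : Summable fun n => ‖s (e n)‖ ^ 2) (X : H →L[ℂ] H) (f : HilbertBasis ℕ ℂ H) :
    Summable fun n => ‖(s ∘L X) (f n)‖ ^ 2 := by
  have h1 : Summable fun n => ‖(ContinuousLinearMap.adjoint X ∘L s) (e n)‖ ^ 2 := by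
    refine Summable.of_nonneg_of_le (fun _ => by positivity) (fun n => ?_)
      (h.mul_left (‖ContinuousLinearMap.adjoint X‖ ^ 2))
    rw [← mul_pow]
    gcongr
    exact ContinuousLinearMap.le_opNorm (ContinuousLinearMap.adjoint X) (s (e n))
  simpa [ContinuousLinearMap.adjoint_comp, hs] using summable_norm_sq_adjoint h1 f

/-- Cyclicity Tr(s²X) = Tr(sXs); the right side uses the fixed basis `e`, so the trace does not
depend on `f`. -/
lemma hasSum_inner_sq_comp (hs : ContinuousLinearMap.adjoint s = s)
    (h : Summable fun n => ‖s (e n)‖ ^ 2) (X : H →L[ℂ] H) (f : HilbertBasis ℕ ℂ H) :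
    HasSum (fun n => ⟪f n, (s ∘L s) (X (f n))⟫_ℂ) (∑' m, ⟪s (e m), X (s (e m))⟫_ℂ) := by
  have hf : Summable fun n => ‖s (f n)‖ ^ 2 := by
    simpa [hs] using summable_norm_sq_adjoint h f
  obtain ⟨S, h1, h2⟩ := exists_hasSum_inner_adjoint hf (summable_norm_sq_comp hs h X f) e
  have e1 : ∀ n, ⟪f n, (s ∘L s) (X (f n))⟫_ℂ = ⟪s (f n), (s ∘L X) (f n)⟫_ℂ := fun n => by
    conv_rhs => rw [← hs]
    rw [ContinuousLinearMap.adjoint_inner_left, hs]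
    rfl
  have e2 : ∀ m, ⟪ContinuousLinearMap.adjoint (s ∘L X) (e m), ContinuousLinearMap.adjoint s (e m)⟫_ℂ =
      ⟪s (e m), X (s (e m))⟫_ℂ := fun m => by
    rw [ContinuousLinearMap.adjoint_comp, hs, ContinuousLinearMap.comp_apply,
      ContinuousLinearMap.adjoint_inner_left]
  simp_rw [e1]
  simp_rw [e2] at h2
  rwa [h2.tsum_eq]

/-- From |⟨u, v⟩| ≤ ‖u‖² + ‖v‖², whence the factor 2. The bound is uniform in `f` and `X`, as needed
later to exchange a trace with an integral over displaced bases. -/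
lemma tsum_enorm_inner_sq_comp_le (hs : ContinuousLinearMap.adjoint s = s) (hX : ‖X‖ ≤ 1)
    (f : HilbertBasis ℕ ℂ H) :
    ∑' n, ‖⟪f n, (s ∘L s) (X (f n))⟫_ℂ‖ₑ ≤ 2 * ∑' n, ‖s (e n)‖ₑ ^ 2 := by
  have h1 : ∑' n, ‖s (f n)‖ₑ ^ 2 = ∑' n, ‖s (e n)‖ₑ ^ 2 := by
    rw [tsum_enorm_sq_adjoint f e, hs]
  have h2 : ∑' n, ‖(s ∘L X) (f n)‖ₑ ^ 2 ≤ ∑' n, ‖s (e n)‖ₑ ^ 2 := by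
    rw [tsum_enorm_sq_adjoint f e, ContinuousLinearMap.adjoint_comp, hs]
    refine ENNReal.tsum_le_tsum fun n => ?_
    gcongr
    rw [ContinuousLinearMap.comp_apply, ← ofReal_norm, ← ofReal_norm]
    refine ENNReal.ofReal_le_ofReal ((ContinuousLinearMap.le_opNorm _ _).trans ?_)
    rw [LinearIsometryEquiv.norm_map]
    exact mul_le_of_le_one_left (norm_nonneg _) hX
  have h3 : ∀ n, ‖⟪f n, (s ∘L s) (X (f n))⟫_ℂ‖ₑ ≤ ‖s (f n)‖ₑ ^ 2 + ‖(s ∘L X) (f n)‖ₑ ^ 2 := by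
    intro n
    have e1 : ⟪f n, (s ∘L s) (X (f n))⟫_ℂ = ⟪s (f n), (s ∘L X) (f n)⟫_ℂ := by
      conv_rhs => rw [← hs]
      rw [ContinuousLinearMap.adjoint_inner_left, hs]
      rfl
    rw [e1, ← ofReal_norm, ← ofReal_norm, ← ofReal_norm, ← ENNReal.ofReal_pow (norm_nonneg _),
      ← ENNReal.ofReal_pow (norm_nonneg _), ← ENNReal.ofReal_add (by positivity) (by positivity)]
    refine ENNReal.ofReal_le_ofReal ((norm_inner_le_norm _ _).trans ?_)
    nlinarith [sq_nonneg (‖s (f n)‖ - ‖(s ∘L X) (f n)‖), sq_nonneg ‖s (f n)‖,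
      sq_nonneg ‖(s ∘L X) (f n)‖]
  refine (ENNReal.tsum_le_tsum h3).trans ?_
  rw [ENNReal.tsum_add, h1, two_mul]
  gcongr

end HilbertSchmidt

/-! ### Traces and characteristic functions of trace-class operators -/

/-- A finite-trace positive operator is the square of a self-adjoint Hilbert–Schmidt operator. -/
lemma exists_hilbertSchmidt_sqrt {P : Fock →L[ℂ] Fock} (hP : P.IsPositive)
    (ht : Summable fun n => ⟪numberState n, P (numberState n)⟫_ℂ) :
    ∃ s : Fock →L[ℂ] Fock, ContinuousLinearMap.adjoint s = s ∧ P = s ∘L s ∧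
      Summable fun n => ‖s (numberBasis n)‖ ^ 2 := by
  obtain ⟨s, hs, rfl⟩ := hP.exists_sqrt
  refine ⟨s, hs, rfl, ?_⟩
  refine (Complex.hasSum_re ht.hasSum).summable.congr fun n => ?_
  rw [numberBasis_apply, ContinuousLinearMap.comp_apply, ← ContinuousLinearMap.adjoint_inner_left, hs,
    inner_self_eq_norm_sq_to_K]
  norm_cast

/-- The trace of a product with a trace-class operator does not depend on the basis. -/
lemma hasSum_opTrace_comp {ρ : Fock →L[ℂ] Fock} (hρ : ρ ∈ TraceClass) (X : Fock →L[ℂ] Fock)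
    (f : HilbertBasis ℕ ℂ Fock) : HasSum (fun n => ⟪f n, ρ (X (f n))⟫_ℂ) (opTrace (ρ ∘L X)) := by
  have main : ∃ S, ∀ f : HilbertBasis ℕ ℂ Fock, HasSum (fun n => ⟪f n, ρ (X (f n))⟫_ℂ) S := by
    induction hρ using Submodule.span_induction with
    | mem P hP =>
      obtain ⟨s, hs, rfl, h⟩ := exists_hilbertSchmidt_sqrt hP.1 hP.2
      exact ⟨_, fun f => hasSum_inner_sq_comp hs h X f⟩
    | zero => exact ⟨0, fun f => by simp [hasSum_zero]⟩
    | add a b _ _ ha hb =>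
      obtain ⟨S, hS⟩ := ha
      obtain ⟨S', hS'⟩ := hb
      exact ⟨S + S', fun f => by
        simpa only [_root_.add_apply, inner_add_right] using (hS f).add (hS' f)⟩
    | smul c a _ ha =>
      obtain ⟨S, hS⟩ := ha
      exact ⟨c * S, fun f => by
        simpa only [_root_.smul_apply, inner_smul_right] using (hS f).mul_left c⟩
  obtain ⟨S, hS⟩ := main
  have h0 : opTrace (ρ ∘L X) = S := by
    have := (hS numberBasis).tsum_eq
    simp_rw [numberBasis_apply] at this
    exact this
  rw [h0]
  exact hS f

lemma exists_tsum_enorm_le {ρ : Fock →L[ℂ] Fock} (hρ : ρ ∈ TraceClass) :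
    ∃ C : ℝ≥0∞, C ≠ ∞ ∧ ∀ (X : Fock →L[ℂ] Fock) (f : HilbertBasis ℕ ℂ Fock), ‖X‖ ≤ 1 →
      ∑' n, ‖⟪f n, ρ (X (f n))⟫_ℂ‖ₑ ≤ C := by
  induction hρ using Submodule.span_induction with
  | mem P hP =>
    obtain ⟨s, hs, rfl, h⟩ := exists_hilbertSchmidt_sqrt hP.1 hP.2
    refine ⟨2 * ∑' n, ‖s (numberBasis n)‖ₑ ^ 2, ?_, fun X f hX =>
      tsum_enorm_inner_sq_comp_le hs hX f⟩
    exact ENNReal.mul_ne_top (by simp) ((summable_norm_sq_iff _).1 h)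
  | zero => exact ⟨0, by simp, fun X f _ => by simp⟩
  | add a b _ _ ha hb =>
    obtain ⟨C, hC, h⟩ := ha
    obtain ⟨C', hC', h'⟩ := hb
    refine ⟨C + C', ENNReal.add_ne_top.2 ⟨hC, hC'⟩, fun X f hX => ?_⟩
    refine le_trans ?_ (add_le_add (h X f hX) (h' X f hX))
    rw [← ENNReal.tsum_add]
    refine ENNReal.tsum_le_tsum fun n => ?_
    rw [_root_.add_apply, inner_add_right]
    exact enorm_add_le _ _
  | smul c a _ ha =>
    obtain ⟨C, hC, h⟩ := ha
    refine ⟨‖c‖ₑ * C, ENNReal.mul_ne_top (by simp) hC, fun X f hX => ?_⟩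
    refine le_trans (le_of_eq ?_) (mul_le_mul_right (h X f hX) _)
    rw [← ENNReal.tsum_mul_left]
    refine tsum_congr fun n => ?_
    rw [_root_.smul_apply, inner_smul_right, enorm_mul]

/-- For ρ = s² the trace is Σ ⟨s e, D(ξ) s e⟩, whose terms are continuous and dominated by the
summable ‖s e‖²; linearity does the rest. -/
lemma continuous_charFn {ρ : Fock →L[ℂ] Fock} (hρ : ρ ∈ TraceClass) : Continuous (charFn ρ) := by
  have hadd : ∀ a ∈ TraceClass, ∀ b ∈ TraceClass, ∀ X, opTrace ((a + b) ∘L X) =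
      opTrace (a ∘L X) + opTrace (b ∘L X) := by
    intro a ha b hb X
    refine (hasSum_opTrace_comp (add_mem ha hb) X numberBasis).unique ?_
    simpa only [_root_.add_apply, inner_add_right] using
      (hasSum_opTrace_comp ha X numberBasis).add (hasSum_opTrace_comp hb X numberBasis)
  unfold charFn
  induction hρ using Submodule.span_induction with
  | mem P hP =>
    obtain ⟨s, hs, rfl, h⟩ := exists_hilbertSchmidt_sqrt hP.1 hP.2
    have e : ∀ ξ, opTrace ((s ∘L s) ∘L displacement ξ) =
        ∑' m, ⟪s (numberBasis m), displacement ξ (s (numberBasis m))⟫_ℂ := fun ξ =>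
      (hasSum_opTrace_comp (Submodule.subset_span hP) _ numberBasis).unique
        (hasSum_inner_sq_comp hs h _ _)
    simp_rw [e]
    refine continuous_tsum (fun m => ?_) h fun m ξ => ?_
    · exact continuous_const.inner (continuous_displacement_apply _)
    · refine (norm_inner_le_norm _ _).trans ?_
      rw [norm_displacement_apply, sq]
  | zero => simpa [opTrace] using continuous_const
  | add a b ha hb hca hcb =>
    simp_rw [hadd a ha b hb]
    exact hca.add hcb
  | smul c a _ ha =>
    have e : ∀ X, opTrace ((c • a) ∘L X) = c * opTrace (a ∘L X) := fun X => by
      simp only [opTrace, ContinuousLinearMap.comp_apply, _root_.smul_apply, inner_smul_right,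
        tsum_mul_left]
    simp_rw [e]
    exact continuous_const.mul ha

lemma rankOne_self_mem_traceClass (u : Fock) : InnerProductSpace.rankOne ℂ u u ∈ TraceClass := by
  refine Submodule.subset_span ⟨InnerProductSpace.isPositive_rankOne_self u, ?_⟩
  have h := (numberBasis.hasSum_inner_mul_inner u u).summable
  simp_rw [numberBasis_apply] at h
  simpa only [InnerProductSpace.rankOne_apply, inner_smul_right] using h

/-- Polarization expresses |u⟩⟨v| through four positive rank-one operators. -/
lemma rankOne_mem_traceClass (u v : Fock) : InnerProductSpace.rankOne ℂ u v ∈ TraceClass := by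
  have e : InnerProductSpace.rankOne ℂ u v = (1 / 4 : ℂ) •
      (InnerProductSpace.rankOne ℂ (u + v) (u + v) - InnerProductSpace.rankOne ℂ (u - v) (u - v)
        + Complex.I • InnerProductSpace.rankOne ℂ (u + Complex.I • v) (u + Complex.I • v)
        - Complex.I • InnerProductSpace.rankOne ℂ (u - Complex.I • v) (u - Complex.I • v)) := by
    ext1 x
    simp only [InnerProductSpace.rankOne_apply, _root_.smul_apply, _root_.add_apply,
      _root_.sub_apply, inner_add_left, inner_sub_left, inner_smul_left, Complex.conj_I]
    generalize ⟪u, x⟫_ℂ = a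
    generalize ⟪v, x⟫_ℂ = b
    match_scalars
    · linear_combination (b / 2) * Complex.I_mul_I
    · linear_combination -(a / 2) * Complex.I_mul_I
  rw [e]
  exact Submodule.smul_mem _ _ (sub_mem (add_mem (sub_mem (rankOne_self_mem_traceClass _)
    (rankOne_self_mem_traceClass _)) (Submodule.smul_mem _ _ (rankOne_self_mem_traceClass _)))
    (Submodule.smul_mem _ _ (rankOne_self_mem_traceClass _)))

lemma opTrace_rankOne_comp (u v : Fock) (X : Fock →L[ℂ] Fock) :
    opTrace (InnerProductSpace.rankOne ℂ u v ∘L X) = ⟪v, X u⟫_ℂ := by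
  have h := numberBasis.hasSum_inner_mul_inner (ContinuousLinearMap.adjoint X v) u
  rw [ContinuousLinearMap.adjoint_inner_left] at h
  rw [← h.tsum_eq]
  refine tsum_congr fun n => ?_
  rw [ContinuousLinearMap.comp_apply, InnerProductSpace.rankOne_apply, inner_smul_right,
    ContinuousLinearMap.adjoint_inner_left, numberBasis_apply]

/-! ### Positive-definite functions and Bochner's theorem -/

section Bochner

open Filter Topology FourierTransform
open scoped ComplexOrder RealInnerProductSpace ENNReal NNReal

lemma nonneg_of_ofReal_mul_nonneg {c : ℝ} (hc : 0 < c) {z : ℂ} (h : 0 ≤ (c : ℂ) * z) : 0 ≤ z := by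
  rw [Complex.nonneg_iff] at h ⊢
  simp only [Complex.re_ofReal_mul, Complex.im_ofReal_mul] at h
  exact ⟨nonneg_of_mul_nonneg_right h.1 hc, by simpa [hc.ne', eq_comm] using h.2⟩

/-- Positive-definite functions on an additive group. -/
def IsPosDefFun {V : Type*} [AddGroup V] (f : V → ℂ) : Prop :=
  ∀ (n : ℕ) (x : Fin n → V) (c : Fin n → ℂ),
    0 ≤ ∑ j, ∑ k, conj (c j) * c k * f (x k - x j)

namespace IsPosDefFun

section Group

variable {V : Type*} [AddCommGroup V] {f : V → ℂ}

lemma zero_nonneg (hf : IsPosDefFun f) : 0 ≤ f 0 := by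
  simpa using hf 1 0 1

lemma two_points (hf : IsPosDefFun f) (x : V) (z : ℂ) :
    0 ≤ f 0 + z * f x + (conj z * f (-x) + conj z * z * f 0) := by
  simpa [Fin.sum_univ_two] using hf 2 ![0, x] ![1, z]

lemma neg_eq_conj (hf : IsPosDefFun f) (x : V) : f (-x) = conj (f x) := by
  have h0 := (Complex.nonneg_iff.1 hf.zero_nonneg).2
  have h1 := (Complex.nonneg_iff.1 (hf.two_points x 1)).2
  have h2 := (Complex.nonneg_iff.1 (hf.two_points x Complex.I)).2
  simp at h1 h2
  apply Complex.ext
  · simp; linarith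
  · simp; linarith

lemma norm_le (hf : IsPosDefFun f) (x : V) : ‖f x‖ ≤ (f 0).re := by
  by_cases hx : f x = 0
  · rw [hx, norm_zero]
    exact (Complex.nonneg_iff.1 hf.zero_nonneg).1
  · have hn : (‖f x‖ : ℂ) ≠ 0 := by simpa using hx
    -- The unimodular z with z · f x = -‖f x‖, which makes `two_points` sharpest.
    set z : ℂ := -(conj (f x) / ‖f x‖) with hz
    have h1 : z * f x = -(‖f x‖ : ℂ) := by
      rw [hz, neg_mul, div_mul_eq_mul_div, Complex.conj_mul', sq, mul_div_assoc, div_self hn, mul_one]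
    have h2 : conj z * f (-x) = -(‖f x‖ : ℂ) := by
      rw [hf.neg_eq_conj, ← map_mul, h1]; simp
    have h3 : conj z * z = 1 := by
      rw [hz, map_neg, neg_mul_neg, map_div₀, Complex.conj_conj, Complex.conj_ofReal,
        div_mul_div_comm, Complex.mul_conj', sq, div_self (mul_ne_zero hn hn)]
    have := (Complex.nonneg_iff.1 (hf.two_points x z)).1
    rw [h1, h2, h3] at this
    simp at this
    linarith

/-- The character at xₖ - xⱼ factors, and its factors are absorbed into the coefficients. -/
lemma mul_char (hf : IsPosDefFun f) (ψ : V →+ ℝ) :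
    IsPosDefFun fun x => Complex.exp (ψ x * Complex.I) * f x := by
  intro n x c
  have e : ∀ j k, conj (c j) * c k * (Complex.exp (ψ (x k - x j) * Complex.I) * f (x k - x j)) =
      conj (c j * Complex.exp (ψ (x j) * Complex.I)) * (c k * Complex.exp (ψ (x k) * Complex.I)) *
        f (x k - x j) := by
    intro j k
    rw [map_sub, map_mul, ← Complex.exp_conj, map_mul, Complex.conj_I, Complex.conj_ofReal,
      Complex.ofReal_sub, sub_mul, Complex.exp_sub, mul_neg, Complex.exp_neg]
    have := Complex.exp_ne_zero (ψ (x j) * Complex.I)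
    field_simp
  simp_rw [e]
  exact hf n x _

end Group

variable {V : Type*} [NormedAddCommGroup V] [MeasurableSpace V] [BorelSpace V]
  [SecondCountableTopology V] {f : V → ℂ}

/-- Averaging over independent points. -/
lemma integral_sub_nonneg (hf : IsPosDefFun f) (hc : Continuous f) (ν : Measure V)
    [IsProbabilityMeasure ν] : 0 ≤ ∫ p : V × V, f (p.1 - p.2) ∂(ν.prod ν) := by
  set I := ∫ p : V × V, f (p.1 - p.2) ∂(ν.prod ν) with hI
  -- Take the expected positivity inequality at m + 2 independent ν-random points with unit
  -- coefficients and divide by m + 2. As m grows, the diagonal term f 0 becomes negligible, so the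
  -- real part of I cannot be negative.
  have key : ∀ m : ℕ, 0 ≤ f 0 + ((m + 1 : ℕ) : ℂ) * I := by
    intro m
    let π : Measure (Fin (m + 2) → V) := Measure.pi fun _ => ν
    have hpair : ∀ j k : Fin (m + 2), j ≠ k → ∫ x, f (x k - x j) ∂π = I := by
      intro j k hjk
      have hind := ((ProbabilityTheory.iIndepFun_pi (μ := fun _ : Fin (m + 2) => ν)
        (X := fun _ => id) fun _ => aemeasurable_id).indepFun hjk.symm)
      simp only [id] at hind
      rw [ProbabilityTheory.indepFun_iff_map_prod_eq_prod_map_map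
        (measurable_pi_apply k).aemeasurable (measurable_pi_apply j).aemeasurable] at hind
      have hk : ∀ i : Fin (m + 2), Measure.map (fun x : Fin (m + 2) → V => x i) π = ν := fun i =>
        (measurePreserving_eval (fun _ : Fin (m + 2) => ν) i).map_eq
      rw [hk, hk] at hind
      rw [hI, ← hind, integral_map]
      · exact ((measurable_pi_apply k).prodMk (measurable_pi_apply j)).aemeasurable
      · exact (hc.comp (continuous_fst.sub continuous_snd)).aestronglyMeasurable
    have hint : ∀ j k : Fin (m + 2), Integrable (fun x => f (x k - x j)) π := by
      intro j k
      refine Integrable.of_bound (C := (f 0).re) ?_ (Eventually.of_forall fun x => hf.norm_le _)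
      exact (hc.comp ((continuous_apply k).sub (continuous_apply j))).aestronglyMeasurable
    have h1 : 0 ≤ ∫ x, ∑ j, ∑ k, f (x k - x j) ∂π := by
      refine integral_nonneg fun x => ?_
      simpa using hf (m + 2) x 1
    rw [integral_finsetSum _ fun j _ => integrable_finsetSum _ fun k _ => hint j k] at h1
    have h2 : ∀ j : Fin (m + 2), ∫ x, ∑ k, f (x k - x j) ∂π = f 0 + ((m + 1 : ℕ) : ℂ) * I := by
      intro j
      rw [integral_finsetSum _ fun k _ => hint j k, ← Finset.add_sum_erase _ _ (Finset.mem_univ j)]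
      congr 1
      · simp
      · rw [Finset.sum_congr rfl fun k hk => hpair j k (Finset.ne_of_mem_erase hk).symm,
          Finset.sum_const, Finset.card_erase_of_mem (Finset.mem_univ j)]
        simp
    rw [Finset.sum_congr rfl fun j _ => h2 j, Finset.sum_const, Finset.card_univ, Fintype.card_fin,
      nsmul_eq_mul] at h1
    have hm : (0 : ℝ) < ((m + 2 : ℕ) : ℝ) := by exact_mod_cast Nat.succ_pos _
    exact nonneg_of_ofReal_mul_nonneg hm (by simpa using h1)
  have h0 := Complex.nonneg_iff.1 hf.zero_nonneg
  rw [Complex.nonneg_iff]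
  constructor
  · by_contra! hneg
    obtain ⟨m, hm⟩ := exists_nat_gt ((f 0).re / -I.re)
    have h1 := (Complex.nonneg_iff.1 (key m)).1
    rw [div_lt_iff₀ (by linarith)] at hm
    simp at h1
    nlinarith
  · have h1 := (Complex.nonneg_iff.1 (key 0)).2
    simp at h1
    linarith [h0.2]

end IsPosDefFun

variable {V : Type*} [NormedAddCommGroup V] [InnerProductSpace ℝ V] [MeasurableSpace V]
  [BorelSpace V] [FiniteDimensional ℝ V] {f : V → ℂ}

lemma integrable_gaussian {b : ℝ} (hb : 0 < b) : Integrable fun v : V => Real.exp (-b * ‖v‖ ^ 2) := by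
  have := GaussianFourier.integrable_cexp_neg_mul_sq_norm_add (V := V) (b := b) (by simpa) 0 0
  have h2 := this.norm
  refine h2.congr (Eventually.of_forall fun v => ?_)
  simp only [Complex.norm_exp]
  congr 1
  simp [← Complex.ofReal_pow]

lemma integral_gaussian_pos {b : ℝ} (hb : 0 < b) : 0 < ∫ v : V, Real.exp (-b * ‖v‖ ^ 2) := by
  rw [GaussianFourier.integral_rexp_neg_mul_sq_norm hb]
  positivity

/-- The difference of two independent Gaussian points with density proportional to e^{-2a‖x‖²} has
density proportional to e^{-a‖u‖²}, so this is `integral_sub_nonneg` up to a positive constant. -/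
lemma IsPosDefFun.integral_mul_gaussian_nonneg (hf : IsPosDefFun f) (hc : Continuous f) {a : ℝ}
    (ha : 0 < a) : 0 ≤ ∫ u, f u * (Real.exp (-a * ‖u‖ ^ 2) : ℝ) := by
  set g : V → ℝ := fun x => Real.exp (-(2 * a) * ‖x‖ ^ 2) with hg
  have hgc : Continuous g := by fun_prop
  have hgi : Integrable g := integrable_gaussian (by positivity)
  set Z := ∫ x, g x with hZ
  have hZ0 : 0 < Z := integral_gaussian_pos (by positivity)
  set w : V → ℝ≥0 := fun x => Real.toNNReal (Z⁻¹ * g x) with hw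
  have hwc : Continuous w := by fun_prop
  have hwr : ∀ x, (w x : ℝ) = Z⁻¹ * g x := fun x => Real.coe_toNNReal _ (by positivity)
  let ν : Measure V := volume.withDensity fun x => w x
  have hν : IsProbabilityMeasure ν := by
    refine ⟨?_⟩
    rw [withDensity_apply _ MeasurableSet.univ, setLIntegral_univ]
    have : ∀ x, (w x : ℝ≥0∞) = ENNReal.ofReal (Z⁻¹ * g x) := fun x => rfl
    simp_rw [this]
    rw [← ofReal_integral_eq_lintegral_ofReal (hgi.const_mul _)
      (Eventually.of_forall fun x => by positivity), integral_const_mul, ← hZ,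
      inv_mul_cancel₀ hZ0.ne', ENNReal.ofReal_one]
  have h0 := hf.integral_sub_nonneg hc ν
  have hfi : Integrable (fun p : V × V => f (p.1 - p.2)) (ν.prod ν) := by
    refine Integrable.of_bound (C := (f 0).re) ?_ (Eventually.of_forall fun x => hf.norm_le _)
    exact (hc.comp (continuous_fst.sub continuous_snd)).aestronglyMeasurable
  rw [integral_prod_symm _ hfi] at h0
  have e1 : ∀ F : V → ℂ, ∫ x, F x ∂ν = ∫ x, (Z : ℂ)⁻¹ * (g x * F x) := by
    intro F
    rw [integral_withDensity_eq_integral_smul hwc.measurable]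
    refine integral_congr_ae (Eventually.of_forall fun x => ?_)
    change ((w x : ℝ) : ℂ) * F x = _
    rw [hwr]
    push_cast
    ring
  simp_rw [e1, integral_const_mul] at h0
  have e2 : ∀ y, ∫ x, (g x : ℂ) * f (x - y) = ∫ u, (g (u + y) : ℂ) * f u := by
    intro y
    rw [← integral_add_right_eq_self (fun x => (g x : ℂ) * f (x - y)) y]
    simp
  -- Completing the square in y; the second factor integrates to a constant independent of u.
  have e3 : ∀ u y : V, g y * g (u + y) = Real.exp (-a * ‖u‖ ^ 2) * Real.exp (-(4 * a) * ‖y + (1 / 2 : ℝ) • u‖ ^ 2) := by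
    intro u y
    rw [hg, ← Real.exp_add, ← Real.exp_add]
    congr 1
    rw [norm_add_sq_real, norm_add_sq_real, norm_smul, real_inner_smul_right, real_inner_comm]
    simp
    ring
  have h1 : 0 ≤ ∫ y, ∫ u, ((g y * g (u + y) : ℝ) : ℂ) * f u := by
    simp_rw [e2] at h0
    have e4 : ∀ y, (g y : ℂ) * ((Z : ℂ)⁻¹ * ∫ u, (g (u + y) : ℂ) * f u) =
        (Z : ℂ)⁻¹ * ∫ u, ((g y * g (u + y) : ℝ) : ℂ) * f u := by
      intro y
      rw [mul_left_comm, ← integral_const_mul]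
      simp only [Complex.ofReal_mul, mul_assoc]
    simp_rw [e4, integral_const_mul] at h0
    rw [← Complex.ofReal_inv] at h0
    exact nonneg_of_ofReal_mul_nonneg (inv_pos.2 hZ0) (nonneg_of_ofReal_mul_nonneg (inv_pos.2 hZ0) h0)
  have hsw : Integrable (Function.uncurry fun y u : V => ((g y * g (u + y) : ℝ) : ℂ) * f u)
      ((volume : Measure V).prod volume) := by
    have hm : AEStronglyMeasurable (Function.uncurry fun y u : V => ((g y * g (u + y) : ℝ) : ℂ) * f u)
      ((volume : Measure V).prod volume) := by
      refine Continuous.aestronglyMeasurable ?_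
      simp only [Function.uncurry_def]
      fun_prop
    have hb := ((measurePreserving_prod_add (volume : Measure V) volume).integrable_comp_of_integrable
      (hgi.mul_prod hgi)).mul_const (f 0).re
    refine hb.mono' hm (Eventually.of_forall fun p => ?_)
    simp only [Function.uncurry_def, Function.comp_apply, norm_mul, Complex.norm_real]
    rw [Real.norm_of_nonneg (Real.exp_nonneg _), Real.norm_of_nonneg (Real.exp_nonneg _),
      add_comm p.2]
    exact mul_le_mul_of_nonneg_left (hf.norm_le _) (by positivity)
  rw [integral_integral_swap hsw] at h1
  set K := ∫ y : V, Real.exp (-(4 * a) * ‖y‖ ^ 2) with hK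
  have hK0 : 0 < K := integral_gaussian_pos (by positivity)
  have e5 : ∀ u, ∫ y, ((g y * g (u + y) : ℝ) : ℂ) * f u =
      (K : ℂ) * (f u * (Real.exp (-a * ‖u‖ ^ 2) : ℝ)) := by
    intro u
    simp_rw [e3]
    rw [integral_mul_const, integral_complex_ofReal, integral_const_mul,
      integral_add_right_eq_self (fun y : V => Real.exp (-(4 * a) * ‖y‖ ^ 2)), ← hK]
    push_cast
    ring
  simp_rw [e5, integral_const_mul] at h1
  exact nonneg_of_ofReal_mul_nonneg hK0 h1

lemma IsPosDefFun.fourier_mul_gaussian_nonneg (hf : IsPosDefFun f) (hc : Continuous f) {a : ℝ}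
    (ha : 0 < a) (w : V) : 0 ≤ 𝓕 (fun u => f u * (Real.exp (-a * ‖u‖ ^ 2) : ℝ)) w := by
  let ψ : V →+ ℝ :=
    { toFun := fun v => -2 * Real.pi * ⟪v, w⟫
      map_zero' := by simp
      map_add' := fun x y => by rw [inner_add_left]; ring }
  have h := (hf.mul_char ψ).integral_mul_gaussian_nonneg (V := V) (by
    change Continuous fun x => Complex.exp (((-2 * Real.pi * ⟪x, w⟫ : ℝ) : ℂ) * Complex.I) * f x
    fun_prop) ha
  rw [Real.fourier_eq']
  refine h.trans_eq (integral_congr_ae (Eventually.of_forall fun u => ?_))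
  exact mul_assoc _ _ _

lemma integrable_mul_gaussian {C : ℝ} (hb : ∀ x, ‖f x‖ ≤ C) (hc : Continuous f) {a : ℝ}
    (ha : 0 < a) : Integrable fun u => f u * (Real.exp (-a * ‖u‖ ^ 2) : ℝ) :=
  (integrable_gaussian ha).ofReal.bdd_mul hc.aestronglyMeasurable (Eventually.of_forall hb)

/-- The Fourier transform of an integrable positive-definite function is nonnegative. -/
lemma IsPosDefFun.fourier_nonneg (hf : IsPosDefFun f) (hc : Continuous f) (hi : Integrable f)
    (w : V) : 0 ≤ 𝓕 f w := by
  have h : Tendsto (fun n : ℕ => 𝓕 (fun u => f u * (Real.exp (-(1 / ((n : ℝ) + 1)) * ‖u‖ ^ 2) : ℝ)) w)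
      atTop (𝓝 (𝓕 f w)) := by
    simp_rw [Real.fourier_eq']
    refine tendsto_integral_of_dominated_convergence (fun u => ‖f u‖) (fun n => ?_) hi.norm
      (fun n => Eventually.of_forall fun u => ?_) (Eventually.of_forall fun u => ?_)
    · refine Continuous.aestronglyMeasurable ?_
      fun_prop
    · rw [norm_smul, Complex.norm_exp_ofReal_mul_I, one_mul, norm_mul, Complex.norm_real,
        Real.norm_of_nonneg (Real.exp_nonneg _)]
      refine mul_le_of_le_one_right (norm_nonneg _) (Real.exp_le_one_iff.2 ?_)
      rw [neg_mul, neg_nonpos]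
      positivity
    · have h1 : Tendsto (fun n : ℕ => Real.exp (-(1 / ((n : ℝ) + 1)) * ‖u‖ ^ 2)) atTop (𝓝 1) := by
        have := (((tendsto_one_div_add_atTop_nhds_zero_nat (𝕜 := ℝ)).neg.mul_const (‖u‖ ^ 2)).rexp)
        simpa using this
      have h2 := ((Complex.continuous_ofReal.tendsto 1).comp h1).const_mul (f u)
      simpa using h2.const_smul (Complex.exp (((-2 * Real.pi * ⟪u, w⟫ : ℝ) : ℂ) * Complex.I))
  exact ge_of_tendsto' h fun n => hf.fourier_mul_gaussian_nonneg hc (by positivity) w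

lemma continuous_fourier_of_integrable (hi : Integrable f) : Continuous (𝓕 f) := by
  exact VectorFourier.fourierIntegral_continuous Real.continuous_fourierChar
    (by exact continuous_inner) hi

/-- If an integrable continuous function has a nonnegative Fourier transform, then this transform
is integrable. -/
lemma integrable_fourier_of_nonneg (hc : Continuous f) (hi : Integrable f)
    (h : ∀ w, 0 ≤ 𝓕 f w) : Integrable (𝓕 f) := by
  have hFc := continuous_fourier_of_integrable hi
  -- Moving the Fourier transform onto the Gaussian turns the integral into f against an approximate
  -- identity at 0.
  have A : Tendsto (fun c : ℝ => ∫ w : V, Complex.exp (-c⁻¹ * ‖w‖ ^ 2) * 𝓕 f w) atTop (𝓝 (f 0)) := by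
    refine (Real.tendsto_integral_gaussian_smul' hi hc.continuousAt).congr' ?_
    filter_upwards [Ioi_mem_atTop 0] with c (hc : 0 < c)
    have J : Integrable fun w : V => Complex.exp (-c⁻¹ * ‖w‖ ^ 2) := by
      simpa using GaussianFourier.integrable_cexp_neg_mul_sq_norm_add (V := V) (b := (c : ℂ)⁻¹)
        (by rw [← Complex.ofReal_inv]; simpa) 0 0
    have h1 := (VectorFourier.integral_fourierIntegral_smul_eq_flip (L := innerₗ V)
      Real.continuous_fourierChar continuous_inner J hi)
    refine Eq.trans ?_ (h1.trans ?_)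
    · refine integral_congr_ae (Eventually.of_forall fun w => ?_)
      change _ = 𝓕 (fun w : V => Complex.exp (-c⁻¹ * ‖w‖ ^ 2)) w • f w
      rw [fourier_gaussian_innerProductSpace (by simpa)]
      simp only [zero_sub, norm_neg, Complex.ofReal_inv, div_inv_eq_mul]
      rw [mul_right_comm]
    · simp only [smul_eq_mul, flip_innerₗ]
      rfl
  have B : ∀ c : ℝ, ∫ w : V, Complex.exp (-c⁻¹ * ‖w‖ ^ 2) * 𝓕 f w =
      ((∫ w : V, Real.exp (-c⁻¹ * ‖w‖ ^ 2) * ‖𝓕 f w‖ : ℝ) : ℂ) := by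
    intro c
    rw [← integral_complex_ofReal]
    refine integral_congr_ae (Eventually.of_forall fun w => ?_)
    simp only [Complex.ofReal_mul, Complex.ofReal_exp]
    rw [← Complex.eq_coe_norm_of_nonneg (h w)]
    push_cast
    rfl
  have C : Tendsto (fun n : ℕ => ∫ w : V, Real.exp (-((n : ℝ) + 1)⁻¹ * ‖w‖ ^ 2) * ‖𝓕 f w‖) atTop
      (𝓝 (f 0).re) := by
    have h1 := (Complex.continuous_re.tendsto _).comp A
    have h2 := h1.comp (tendsto_natCast_atTop_atTop.atTop_add (tendsto_const_nhds (x := (1 : ℝ))))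
    refine h2.congr fun n => ?_
    simp only [Function.comp_apply, B, Complex.ofReal_re]
  refine ⟨hFc.aestronglyMeasurable, ?_⟩
  have hD : ∀ n : ℕ, Integrable fun w : V => Real.exp (-((n : ℝ) + 1)⁻¹ * ‖w‖ ^ 2) * ‖𝓕 f w‖ :=
    fun n => (integrable_gaussian (by positivity)).mul_bdd hFc.norm.aestronglyMeasurable
      (Eventually.of_forall fun w => by
        rw [norm_norm]
        exact VectorFourier.norm_fourierIntegral_le_integral_norm _ _ (innerₗ V) f w)
  -- Fatou's lemma: as 𝓕 f is its own modulus, the limit in `C` bounds the L¹ norm.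
  have hF : ∫⁻ w, ‖𝓕 f w‖ₑ ≤ ENNReal.ofReal (f 0).re := by
    have hlim : ∀ w, Tendsto (fun n : ℕ =>
        ENNReal.ofReal (Real.exp (-((n : ℝ) + 1)⁻¹ * ‖w‖ ^ 2) * ‖𝓕 f w‖)) atTop (𝓝 ‖𝓕 f w‖ₑ) := by
      intro w
      rw [← ofReal_norm]
      refine ENNReal.tendsto_ofReal ?_
      have h1 : Tendsto (fun n : ℕ => Real.exp (-((n : ℝ) + 1)⁻¹ * ‖w‖ ^ 2)) atTop (𝓝 1) := by
        have := (((tendsto_one_div_add_atTop_nhds_zero_nat (𝕜 := ℝ)).neg.mul_const (‖w‖ ^ 2)).rexp)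
        simpa using this
      simpa using h1.mul_const ‖𝓕 f w‖
    calc ∫⁻ w, ‖𝓕 f w‖ₑ = ∫⁻ w, liminf (fun n : ℕ =>
          ENNReal.ofReal (Real.exp (-((n : ℝ) + 1)⁻¹ * ‖w‖ ^ 2) * ‖𝓕 f w‖)) atTop := by
          simp_rw [fun w => (hlim w).liminf_eq]
      _ ≤ liminf (fun n : ℕ => ∫⁻ w, ENNReal.ofReal
          (Real.exp (-((n : ℝ) + 1)⁻¹ * ‖w‖ ^ 2) * ‖𝓕 f w‖)) atTop := by
          refine lintegral_liminf_le fun n => ?_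
          have := hFc.norm.measurable
          fun_prop
      _ = ENNReal.ofReal (f 0).re := by
          refine Tendsto.liminf_eq ?_
          refine (ENNReal.tendsto_ofReal C).congr fun n => ?_
          exact ofReal_integral_eq_lintegral_ofReal (hD n)
            (Eventually.of_forall fun w => by positivity)
  exact hF.trans_lt ENNReal.ofReal_lt_top

lemma fourierInv_eq_integral_exp (g : V → ℂ) (t : V) :
    𝓕⁻ g t = ∫ w, Complex.exp (⟪w, (2 * Real.pi) • t⟫ * Complex.I) * g w := by
  rw [Real.fourierInv_eq']
  refine integral_congr_ae (Eventually.of_forall fun w => ?_)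
  simp only [smul_eq_mul, real_inner_smul_right]

/-- The probability measure whose Fourier transform is a given integrable function. -/
lemma exists_measure_of_fourier_nonneg (hc : Continuous f) (hi : Integrable f)
    (h : ∀ w, 0 ≤ 𝓕 f w) (h1 : f 0 = 1) :
    ∃ μ : Measure V, IsProbabilityMeasure μ ∧ ∀ t, charFun μ ((2 * Real.pi) • t) = f t := by
  have hFi := integrable_fourier_of_nonneg hc hi h
  have hFc := continuous_fourier_of_integrable hi
  have hinv := hc.fourierInv_fourier_eq hi hFi
  set w : V → ℝ≥0 := fun x => ‖𝓕 f x‖₊ with hw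
  have hwc : Continuous w := hFc.nnnorm
  have key : ∀ t, charFun (volume.withDensity fun x => (w x : ℝ≥0∞)) ((2 * Real.pi) • t) = f t := by
    intro t
    rw [charFun_apply, integral_withDensity_eq_integral_smul hwc.measurable, ← congrFun hinv t,
      fourierInv_eq_integral_exp]
    refine integral_congr_ae (Eventually.of_forall fun x => ?_)
    simp only []
    rw [Complex.eq_coe_norm_of_nonneg (h x), mul_comm _ (‖𝓕 f x‖ : ℂ)]
    rfl
  have hfin : IsFiniteMeasure (volume.withDensity fun x => (w x : ℝ≥0∞)) :=
    isFiniteMeasure_withDensity hFi.2.ne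
  refine ⟨_, ⟨?_⟩, key⟩
  have h2 := key 0
  rw [smul_zero, charFun_zero, h1] at h2
  have h3 : (volume.withDensity fun x => (w x : ℝ≥0∞)).real Set.univ = 1 := by exact_mod_cast h2
  rwa [measureReal_def, ENNReal.toReal_eq_one_iff] at h3

/-- **Bochner's theorem**. -/
theorem IsPosDefFun.exists_charFun_eq (hf : IsPosDefFun f) (hc : Continuous f) (h1 : f 0 = 1) :
    ∃ μ : Measure V, IsProbabilityMeasure μ ∧ ∀ t, charFun μ ((2 * Real.pi) • t) = f t := by
  have hpi : (2 * Real.pi) ≠ 0 := by positivity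
  have hn : ∀ n : ℕ, (0 : ℝ) < 1 / ((n : ℝ) + 1) := fun n => by positivity
  -- Gaussian damping makes f integrable, keeps its transform nonnegative and leaves the value 1 at
  -- 0.
  have h0 : ∀ n : ℕ, ∃ μ : Measure V, IsProbabilityMeasure μ ∧ ∀ t, charFun μ ((2 * Real.pi) • t) =
      f t * (Real.exp (-(1 / ((n : ℝ) + 1)) * ‖t‖ ^ 2) : ℝ) := fun n =>
    exists_measure_of_fourier_nonneg (by fun_prop) (integrable_mul_gaussian hf.norm_le hc (hn n))
      (hf.fourier_mul_gaussian_nonneg hc (hn n)) (by simp [h1])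
  choose μ hμ hμf using h0
  have hlim : ∀ t, Tendsto (fun n => charFun (μ n) t) atTop (𝓝 (f ((2 * Real.pi)⁻¹ • t))) := by
    intro t
    have e : ∀ n, charFun (μ n) t = f ((2 * Real.pi)⁻¹ • t) *
        (Real.exp (-(1 / ((n : ℝ) + 1)) * ‖(2 * Real.pi)⁻¹ • t‖ ^ 2) : ℝ) := fun n => by
      rw [← hμf, smul_inv_smul₀ hpi]
    simp_rw [e]
    generalize (2 * Real.pi)⁻¹ • t = u
    have h1 : Tendsto (fun n : ℕ => Real.exp (-(1 / ((n : ℝ) + 1)) * ‖u‖ ^ 2)) atTop (𝓝 1) := by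
      have := (((tendsto_one_div_add_atTop_nhds_zero_nat (𝕜 := ℝ)).neg.mul_const (‖u‖ ^ 2)).rexp)
      simpa using this
    simpa using ((Complex.continuous_ofReal.tendsto 1).comp h1).const_mul (f u)
  -- A limit of characteristic functions that is continuous forces tightness. By Prokhorov the
  -- measures then converge weakly along an ultrafilter, which serves in place of a subsequence.
  have htight := isTightMeasureSet_of_tendsto_charFun (μ := μ)
    (f := fun t => f ((2 * Real.pi)⁻¹ • t)) (by fun_prop) hlim
  let P : ℕ → ProbabilityMeasure V := fun n => ⟨μ n, hμ n⟩
  have hcomp : IsCompact (closure (Set.range P)) := by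
    refine isCompact_closure_of_isTightMeasureSet ?_
    refine htight.subset ?_
    rintro _ ⟨_, ⟨n, rfl⟩, rfl⟩
    exact ⟨n, rfl⟩
  obtain ⟨ν, -, hν⟩ := hcomp.ultrafilter_le_nhds ((hyperfilter ℕ).map P)
    (.trans (by simp) (principal_mono.2 subset_closure))
  refine ⟨ν, inferInstance, fun t => ?_⟩
  have hν' : Tendsto P (hyperfilter ℕ) (𝓝 ν) := hν
  rw [ProbabilityMeasure.tendsto_iff_forall_integral_rclike_tendsto ℂ] at hν'
  have h2 := hν' (BoundedContinuousFunction.innerProbChar ((2 * Real.pi) • t))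
  simp_rw [← charFun_eq_integral_innerProbChar] at h2
  refine tendsto_nhds_unique h2 ?_
  have h3 := (hlim ((2 * Real.pi) • t)).mono_left (Nat.hyperfilter_le_atTop)
  rwa [inv_smul_smul₀ hpi] at h3

end Bochner

/-! ### Averages over displacements -/

section Twirl

open Filter Topology
open scoped ComplexOrder ENNReal NNReal

lemma inner_displacement_right (α : ℂ) (x y : Fock) :
    ⟪x, displacement α y⟫_ℂ = ⟪displacement (-α) x, y⟫_ℂ := by
  rw [← adjoint_displacement, ContinuousLinearMap.adjoint_inner_left]

lemma norm_displacement_le (α : ℂ) : ‖displacement α‖ ≤ 1 :=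
  ContinuousLinearMap.opNorm_le_bound _ zero_le_one fun x => by
    rw [norm_displacement_apply, one_mul]

/-- The number basis displaced by `α`. -/
noncomputable def displacedBasis (α : ℂ) : HilbertBasis ℕ ℂ Fock :=
  ⟨(displacementEquiv α).symm.trans numberBasis.repr⟩

lemma displacedBasis_apply (α : ℂ) (n : ℕ) : displacedBasis α n = displacement α (numberState n) := by
  rw [← HilbertBasis.repr_symm_single, ← numberBasis_apply, ← HilbertBasis.repr_symm_single]
  rfl

/-- `T` is the weak integral of `p(α) D(α) ρ D(α)†` with respect to `μ`. -/
def IsWeakTwirl (μ : Measure ℂ) (p : ℂ → ℂ) (ρ T : Fock →L[ℂ] Fock) : Prop :=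
  ∀ x y, ⟪x, T y⟫_ℂ = ∫ α, p α * ⟪displacement (-α) x, ρ (displacement (-α) y)⟫_ℂ ∂μ

lemma inner_displacement_conj (α : ℂ) (ρ : Fock →L[ℂ] Fock) (x y : Fock) :
    ⟪x, (displacement α ∘L ρ ∘L ContinuousLinearMap.adjoint (displacement α)) y⟫_ℂ =
      ⟪displacement (-α) x, ρ (displacement (-α) y)⟫_ℂ := by
  rw [ContinuousLinearMap.comp_apply, inner_displacement_right, adjoint_displacement,
    ContinuousLinearMap.comp_apply]

lemma isDisplacementIntegral_iff {p : ℂ → ℂ} {E : TraceClass →ₗ[ℂ] TraceClass} :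
    IsDisplacementIntegral p E ↔ ∀ ρ : TraceClass, IsWeakTwirl volume p ρ (E ρ) := by
  simp only [IsDisplacementIntegral, IsWeakTwirl, inner_displacement_conj]

lemma continuous_displacement_neg (y : Fock) : Continuous fun α => displacement (-α) y :=
  (continuous_displacement_apply y).comp continuous_neg

variable {μ : Measure ℂ} {p : ℂ → ℂ}

lemma continuous_twirl_kernel (ρ : Fock →L[ℂ] Fock) (x y : Fock) :
    Continuous fun α => ⟪displacement (-α) x, ρ (displacement (-α) y)⟫_ℂ :=
  (continuous_displacement_neg x).inner (ρ.continuous.comp (continuous_displacement_neg y))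

lemma norm_twirl_kernel_le (ρ : Fock →L[ℂ] Fock) (x y : Fock) (α : ℂ) :
    ‖⟪displacement (-α) x, ρ (displacement (-α) y)⟫_ℂ‖ ≤ ‖x‖ * (‖ρ‖ * ‖y‖) := by
  refine (norm_inner_le_norm _ _).trans ?_
  rw [norm_displacement_apply]
  refine mul_le_mul_of_nonneg_left ((ρ.le_opNorm _).trans ?_) (norm_nonneg _)
  rw [norm_displacement_apply]

lemma integrable_twirl_kernel (hp : Integrable p μ) (ρ : Fock →L[ℂ] Fock) (x y : Fock) :
    Integrable (fun α => p α * ⟪displacement (-α) x, ρ (displacement (-α) y)⟫_ℂ) μ :=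
  hp.mul_bdd (continuous_twirl_kernel ρ x y).aestronglyMeasurable
    (Eventually.of_forall fun α => norm_twirl_kernel_le ρ x y α)

lemma norm_twirl_integrand (ρ : Fock →L[ℂ] Fock) (y : Fock) (α : ℂ) :
    ‖displacement α (ρ (displacement (-α) y))‖ ≤ ‖ρ‖ * ‖y‖ := by
  rw [norm_displacement_apply]
  refine (ρ.le_opNorm _).trans ?_
  rw [norm_displacement_apply]

lemma integrable_twirl_integrand (hp : Integrable p μ) (ρ : Fock →L[ℂ] Fock) (y : Fock) :
    Integrable (fun α => p α • displacement α (ρ (displacement (-α) y))) μ :=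
  hp.smul_bdd (‖ρ‖ * ‖y‖) (continuous_displacement_comp continuous_id
      (ρ.continuous.comp (continuous_displacement_neg y))).aestronglyMeasurable
    (Eventually.of_forall fun α => norm_twirl_integrand ρ y α)

/-- The operator `∫ p(α) D(α) ρ D(α)† dμ(α)`. -/
noncomputable def twirl (hp : Integrable p μ) :
    (Fock →L[ℂ] Fock) →ₗ[ℂ] (Fock →L[ℂ] Fock) where
  toFun ρ := LinearMap.mkContinuous
    { toFun := fun y => ∫ α, p α • displacement α (ρ (displacement (-α) y)) ∂μ
      map_add' := fun y z => by
        simp only [map_add, smul_add]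
        exact integral_add (integrable_twirl_integrand hp ρ y) (integrable_twirl_integrand hp ρ z)
      map_smul' := fun c y => by
        simp only [map_smul, smul_comm _ c, RingHom.id_apply]
        exact integral_smul c _ }
    ((∫ α, ‖p α‖ ∂μ) * ‖ρ‖) fun y => by
      refine (norm_integral_le_integral_norm _).trans ?_
      rw [mul_assoc, ← integral_mul_const]
      refine integral_mono (integrable_twirl_integrand hp ρ y).norm (hp.norm.mul_const _) fun α => ?_
      simp only [norm_smul]
      exact mul_le_mul_of_nonneg_left (norm_twirl_integrand ρ y α) (norm_nonneg _)
  map_add' ρ σ := by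
    ext1 y
    simp only [_root_.add_apply, map_add, smul_add, LinearMap.mkContinuous_apply, LinearMap.coe_mk,
      AddHom.coe_mk]
    exact integral_add (integrable_twirl_integrand hp ρ y) (integrable_twirl_integrand hp σ y)
  map_smul' c ρ := by
    ext1 y
    simp only [_root_.smul_apply, map_smul, smul_comm _ c, RingHom.id_apply,
      LinearMap.mkContinuous_apply, LinearMap.coe_mk, AddHom.coe_mk]
    exact integral_smul c _

lemma isWeakTwirl_twirl (hp : Integrable p μ) (ρ : Fock →L[ℂ] Fock) :
    IsWeakTwirl μ p ρ (twirl hp ρ) := by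
  intro x y
  change ⟪x, ∫ α, p α • displacement α (ρ (displacement (-α) y)) ∂μ⟫_ℂ = _
  rw [← integral_inner (integrable_twirl_integrand hp ρ y)]
  simp only [inner_smul_right, inner_displacement_right]

lemma norm_fourierKernel (ξ α : ℂ) : ‖fourierKernel ξ α‖ = 1 := by
  rw [fourierKernel, Complex.norm_exp, Real.exp_eq_one_iff]
  simp
  ring

namespace IsWeakTwirl

variable {ρ T : Fock →L[ℂ] Fock}

/-- Commuting D(-α) past D(ξ) releases the kernel and leaves a diagonal entry of ρD(ξ) in the basis
displaced by -α. -/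
lemma inner_displacement (hT : IsWeakTwirl μ p ρ T) (ξ : ℂ) (n : ℕ) :
    ⟪numberState n, T (displacement ξ (numberState n))⟫_ℂ =
      ∫ α, p α * (fourierKernel ξ α *
        ⟪displacedBasis (-α) n, ρ (displacement ξ (displacedBasis (-α) n))⟫_ℂ) ∂μ := by
  rw [hT]
  refine integral_congr_ae (Eventually.of_forall fun α => ?_)
  have h := congrArg (· (displacement (-α) (numberState n))) (displacement_conj α ξ)
  simp only [ContinuousLinearMap.comp_apply, displacement_apply_neg, _root_.smul_apply] at h
  simp only [displacedBasis_apply]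
  rw [h, map_smul, inner_smul_right]

lemma aestronglyMeasurable (hp : Integrable p μ) (ρ : Fock →L[ℂ] Fock) (ξ : ℂ) (n : ℕ) :
    AEStronglyMeasurable (fun α => p α * (fourierKernel ξ α *
        ⟪displacedBasis (-α) n, ρ (displacement ξ (displacedBasis (-α) n))⟫_ℂ)) μ := by
  refine hp.1.mul (Continuous.aestronglyMeasurable ?_)
  simp only [displacedBasis_apply]
  refine Continuous.mul ?_ ((continuous_displacement_neg _).inner (ρ.continuous.comp
    ((displacement ξ).continuous.comp (continuous_displacement_neg _))))
  unfold fourierKernel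
  fun_prop

lemma tsum_lintegral_ne_top (hp : Integrable p μ) (hρ : ρ ∈ TraceClass) (ξ : ℂ) :
    ∑' n, ∫⁻ α, ‖p α * (fourierKernel ξ α *
        ⟪displacedBasis (-α) n, ρ (displacement ξ (displacedBasis (-α) n))⟫_ℂ)‖ₑ ∂μ ≠ ∞ := by
  rw [← lintegral_tsum fun n => (aestronglyMeasurable hp ρ ξ n).enorm]
  obtain ⟨C, hC, h⟩ := exists_tsum_enorm_le hρ
  refine ne_of_lt (lt_of_le_of_lt (b := ∫⁻ α, ‖p α‖ₑ * C ∂μ) (lintegral_mono fun α => ?_) ?_)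
  · simp_rw [enorm_mul, ENNReal.tsum_mul_left]
    have : ‖fourierKernel ξ α‖ₑ = 1 := by rw [← ofReal_norm, norm_fourierKernel, ENNReal.ofReal_one]
    rw [this, one_mul]
    gcongr
    exact h (displacement ξ) _ (norm_displacement_le ξ)
  · rw [lintegral_mul_const' _ _ hC]
    exact ENNReal.mul_lt_top hp.2 hC.lt_top

/-- Exchange sum and integral. For each α the sum over n is the trace of ρD(ξ) in a displaced basis,
which is independent of α, and only the kernel is left to integrate. -/
lemma charFn_eq (hT : IsWeakTwirl μ p ρ T) (hp : Integrable p μ) (hρ : ρ ∈ TraceClass) (ξ : ℂ) :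
    charFn T ξ = charFn ρ ξ * ∫ α, fourierKernel ξ α * p α ∂μ := by
  have h1 : charFn T ξ = ∑' n, ⟪numberState n, T (displacement ξ (numberState n))⟫_ℂ := rfl
  rw [h1]
  simp_rw [hT.inner_displacement]
  rw [← integral_tsum (aestronglyMeasurable hp ρ ξ) (tsum_lintegral_ne_top hp hρ ξ),
    ← integral_const_mul]
  refine integral_congr_ae (Eventually.of_forall fun α => ?_)
  simp only [tsum_mul_left]
  rw [(hasSum_opTrace_comp hρ (displacement ξ) (displacedBasis (-α))).tsum_eq, charFn]
  ring

lemma summable_trace (hT : IsWeakTwirl μ p ρ T) (hp : Integrable p μ) (hρ : ρ ∈ TraceClass) :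
    Summable fun n => ⟪numberState n, T (numberState n)⟫_ℂ := by
  have h := tsum_lintegral_ne_top hp hρ 0
  have e : ∀ n, ⟪numberState n, T (numberState n)⟫_ℂ = _ := fun n => by
    simpa only [displacement_zero, ContinuousLinearMap.id_apply] using hT.inner_displacement 0 n
  have h2 : ∑' n, ‖⟪numberState n, T (numberState n)⟫_ℂ‖ₑ ≠ ∞ := by
    refine ne_top_of_le_ne_top h (ENNReal.tsum_le_tsum fun n => ?_)
    rw [e]
    refine (enorm_integral_le_lintegral_enorm _).trans (le_of_eq ?_)
    simp only [displacement_zero, ContinuousLinearMap.id_apply]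
  refine Summable.of_norm ?_
  have e2 : (fun n => ‖⟪numberState n, T (numberState n)⟫_ℂ‖ₑ) =
    fun n => ((‖⟪numberState n, T (numberState n)⟫_ℂ‖₊ : ℝ≥0) : ℝ≥0∞) := rfl
  rw [e2, ENNReal.tsum_coe_ne_top_iff_summable, ← NNReal.summable_coe] at h2
  exact h2

/-- For each α the integrand is the weight p(α) times the original block form on the displaced
tuple. The case k = 1 gives positivity of a single operator. -/
lemma sum_nonneg {k : ℕ} {ρ T : Fin k → Fin k → Fock →L[ℂ] Fock}
    (hT : ∀ i j, IsWeakTwirl μ p (ρ i j) (T i j)) (hp : Integrable p μ) (hp0 : 0 ≤ᵐ[μ] p)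
    (hρ : ∀ x : Fin k → Fock, 0 ≤ ∑ i, ∑ j, ⟪x i, ρ i j (x j)⟫_ℂ) (x : Fin k → Fock) :
    0 ≤ ∑ i, ∑ j, ⟪x i, T i j (x j)⟫_ℂ := by
  have e : ∑ i, ∑ j, ⟪x i, T i j (x j)⟫_ℂ =
      ∫ α, p α * ∑ i, ∑ j, ⟪displacement (-α) (x i), ρ i j (displacement (-α) (x j))⟫_ℂ ∂μ := by
    simp_rw [Finset.mul_sum]
    rw [integral_finsetSum _ fun i _ => integrable_finsetSum _ fun j _ =>
      integrable_twirl_kernel hp (ρ i j) (x i) (x j)]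
    refine Finset.sum_congr rfl fun i _ => ?_
    rw [integral_finsetSum _ fun j _ => integrable_twirl_kernel hp (ρ i j) (x i) (x j)]
    exact Finset.sum_congr rfl fun j _ => hT i j _ _
  rw [e]
  refine integral_nonneg_of_ae ?_
  filter_upwards [hp0] with α hα
  exact mul_nonneg hα (hρ fun i => displacement (-α) (x i))

lemma mem_traceClass_of_isPositive (hT : IsWeakTwirl μ p ρ T) (hp : Integrable p μ) (hp0 : 0 ≤ᵐ[μ] p)
    (hρ : ρ.IsPositive) (ht : Summable fun n => ⟪numberState n, ρ (numberState n)⟫_ℂ) :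
    T ∈ TraceClass := by
  refine Submodule.subset_span ⟨?_, hT.summable_trace hp (Submodule.subset_span ⟨hρ, ht⟩)⟩
  have h : ∀ x, 0 ≤ ⟪x, T x⟫_ℂ := fun x => by
    simpa using sum_nonneg (k := 1) (ρ := fun _ _ => ρ) (T := fun _ _ => T) (fun _ _ => hT) hp hp0
      (fun x => by simpa using hρ.inner_nonneg_right (x 0)) fun _ => x
  rw [ContinuousLinearMap.isPositive_iff_complex]
  intro x
  have h1 := h x
  obtain ⟨h2, h3⟩ := Complex.nonneg_iff.1 h1
  rw [← inner_conj_symm, Complex.conj_eq_iff_im.2 h3.symm]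
  exact ⟨Complex.ext (by simp) (by simpa using h3), h2⟩

lemma mem_traceClass_of_nonneg (hp : Integrable p μ) (hp0 : 0 ≤ᵐ[μ] p) (hρ : ρ ∈ TraceClass) :
    twirl hp ρ ∈ TraceClass := by
  induction hρ using Submodule.span_induction with
  | mem P hP => exact (isWeakTwirl_twirl hp P).mem_traceClass_of_isPositive hp hp0 hP.1 hP.2
  | zero => rw [map_zero]; exact zero_mem _
  | add a b _ _ ha hb => rw [map_add]; exact add_mem ha hb
  | smul c a _ ha => rw [map_smul]; exact Submodule.smul_mem _ _ ha

/-- Split p into positive and negative parts of its real and imaginary parts: a nonnegative weight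
sends positive operators of finite trace to such operators. -/
lemma mem_traceClass (hT : IsWeakTwirl μ p ρ T) (hp : Integrable p μ) (hρ : ρ ∈ TraceClass) :
    T ∈ TraceClass := by
  have hnn : ∀ q : ℂ → ℝ, (0 : ℂ → ℂ) ≤ᵐ[μ] fun α => ((max (q α) 0 : ℝ) : ℂ) := fun q =>
    Eventually.of_forall fun α => Complex.zero_le_real.2 (le_max_right _ _)
  have h1 : Integrable (fun α => ((max (p α).re 0 : ℝ) : ℂ)) μ := hp.re.pos_part.ofReal
  have h2 : Integrable (fun α => ((max (-(p α).re) 0 : ℝ) : ℂ)) μ := hp.re.neg_part.ofReal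
  have h3 : Integrable (fun α => ((max (p α).im 0 : ℝ) : ℂ)) μ := hp.im.pos_part.ofReal
  have h4 : Integrable (fun α => ((max (-(p α).im) 0 : ℝ) : ℂ)) μ := hp.im.neg_part.ofReal
  have e : T = twirl h1 ρ - twirl h2 ρ + Complex.I • twirl h3 ρ - Complex.I • twirl h4 ρ := by
    refine ContinuousLinearMap.ext fun y => ext_inner_left ℂ fun x => ?_
    have i1 := integrable_twirl_kernel h1 ρ x y
    have i2 := integrable_twirl_kernel h2 ρ x y
    have i3 := integrable_twirl_kernel h3 ρ x y
    have i4 := integrable_twirl_kernel h4 ρ x y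
    simp only [_root_.add_apply, _root_.sub_apply, _root_.smul_apply, inner_add_right,
      inner_sub_right, inner_smul_right]
    rw [hT, isWeakTwirl_twirl h1, isWeakTwirl_twirl h2, isWeakTwirl_twirl h3, isWeakTwirl_twirl h4,
      ← integral_const_mul, ← integral_const_mul]
    have s1 := integral_sub i1 i2
    have s2 := integral_add (i1.sub i2) (i3.const_mul Complex.I)
    have s3 := integral_sub ((i1.sub i2).add (i3.const_mul Complex.I)) (i4.const_mul Complex.I)
    simp only [Pi.sub_apply, Pi.add_apply] at s1 s2 s3
    rw [← s1, ← s2, ← s3]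
    refine integral_congr_ae (Eventually.of_forall fun α => ?_)
    have hr : ((p α).re : ℂ) = ((max (p α).re 0 : ℝ) : ℂ) - ((max (-(p α).re) 0 : ℝ) : ℂ) := by
      rw [← Complex.ofReal_sub, max_zero_sub_max_neg_zero_eq_self]
    have hi : ((p α).im : ℂ) = ((max (p α).im 0 : ℝ) : ℂ) - ((max (-(p α).im) 0 : ℝ) : ℂ) := by
      rw [← Complex.ofReal_sub, max_zero_sub_max_neg_zero_eq_self]
    change p α * _ = _
    conv_lhs => rw [← Complex.re_add_im (p α), hr, hi]
    ring
  rw [e]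
  exact sub_mem (add_mem (sub_mem (mem_traceClass_of_nonneg h1 (hnn _) hρ)
    (mem_traceClass_of_nonneg h2 (hnn _) hρ)) (Submodule.smul_mem _ _
    (mem_traceClass_of_nonneg h3 (hnn _) hρ))) (Submodule.smul_mem _ _
    (mem_traceClass_of_nonneg h4 (hnn _) hρ))

end IsWeakTwirl

/-- The map `ρ ↦ ∫ p(α) D(α) ρ D(α)† dμ(α)` on trace-class operators. -/
noncomputable def twirlTraceClass (hp : Integrable p μ) : TraceClass →ₗ[ℂ] TraceClass :=
  (twirl hp).restrict fun ρ hρ => (isWeakTwirl_twirl hp ρ).mem_traceClass hp hρ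

lemma isWeakTwirl_twirlTraceClass (hp : Integrable p μ) (ρ : TraceClass) :
    IsWeakTwirl μ p ρ (twirlTraceClass hp ρ) := isWeakTwirl_twirl hp ρ

variable {E : TraceClass →ₗ[ℂ] TraceClass}

lemma isFilteringMap_of_isWeakTwirl (hp : Integrable p μ)
    (hE : ∀ ρ : TraceClass, IsWeakTwirl μ p ρ (E ρ)) {Ω : ℂ → ℂ}
    (hΩ : ∀ ξ, Ω ξ = ∫ α, fourierKernel ξ α * p α ∂μ) : IsFilteringMap Ω E := fun ρ ξ => by
  rw [(hE ρ).charFn_eq hp ρ.2, hΩ]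

lemma isPositiveBlock_iff {k : ℕ} {ρ : Fin k → Fin k → TraceClass} : IsPositiveBlock ρ ↔
    ∀ x : Fin k → Fock, 0 ≤ ∑ i, ∑ j, ⟪x i, (ρ i j : Fock →L[ℂ] Fock) (x j)⟫_ℂ :=
  forall_congr' fun x => by rw [Complex.nonneg_iff, eq_comm (a := (0 : ℝ))]

lemma charFn_zero (ρ : Fock →L[ℂ] Fock) : charFn ρ 0 = opTrace ρ := by
  rw [charFn, displacement_zero, ContinuousLinearMap.comp_id]

lemma isCPTP_of_isWeakTwirl (hp : Integrable p μ) (hp0 : 0 ≤ᵐ[μ] p) (hp1 : ∫ α, p α ∂μ = 1)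
    (hE : ∀ ρ : TraceClass, IsWeakTwirl μ p ρ (E ρ)) : IsCPTP E := by
  refine ⟨fun k ρ hρ => ?_, fun ρ => ?_⟩
  · rw [isPositiveBlock_iff] at hρ ⊢
    exact IsWeakTwirl.sum_nonneg (fun i j => hE (ρ i j)) hp hp0 hρ
  · rw [← charFn_zero, ← charFn_zero, (hE ρ).charFn_eq hp ρ.2]
    simp [fourierKernel, hp1]

end Twirl

/-! ### Nonnegativity from the Fourier transform -/

section FourierUniqueness

open Filter Topology
open scoped ComplexOrder RealInnerProductSpace ENNReal NNReal

variable {V : Type*} [NormedAddCommGroup V] [InnerProductSpace ℝ V] [MeasurableSpace V]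

lemma charFun_withDensity_ofReal {μ : Measure V} {r : V → ℝ} (hr : Integrable r μ) (t : V) :
    charFun (μ.withDensity fun v => ENNReal.ofReal (r v)) t =
      ∫ v, Complex.exp (⟪v, t⟫ * Complex.I) * ((max (r v) 0 : ℝ) : ℂ) ∂μ := by
  rw [charFun_apply]
  change ∫ v, _ ∂(μ.withDensity fun v => ((r v).toNNReal : ℝ≥0∞)) = _
  rw [integral_withDensity_eq_integral_smul₀ hr.1.aemeasurable.real_toNNReal]
  refine integral_congr_ae (Eventually.of_forall fun v => ?_)
  simp only [NNReal.smul_def, Real.coe_toNNReal', Complex.real_smul]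
  ring

variable [BorelSpace V]

lemma integrable_exp_inner_mul {μ : Measure V} {p : V → ℂ} (hp : Integrable p μ) (t : V) :
    Integrable (fun v => Complex.exp (⟪v, t⟫ * Complex.I) * p v) μ :=
  hp.bdd_mul (c := 1) (Continuous.aestronglyMeasurable (by fun_prop))
    (Eventually.of_forall fun v => by rw [Complex.norm_exp_ofReal_mul_I])

variable [FiniteDimensional ℝ V]

/-- An integrable real function with the same Fourier transform as a finite measure is nonnegative
almost everywhere. -/
lemma ae_nonneg_of_integral_eq_charFun {ν μ : Measure V} [SigmaFinite ν] [IsFiniteMeasure μ]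
    {r : V → ℝ} (hr : Integrable r ν)
    (h : ∀ t, charFun μ t = ∫ v, Complex.exp (⟪v, t⟫ * Complex.I) * (r v : ℂ) ∂ν) :
    0 ≤ᵐ[ν] r := by
  have hfin : ∀ s : V → ℝ, Integrable s ν →
      IsFiniteMeasure (ν.withDensity fun v => ENNReal.ofReal (s v)) := fun s hs =>
    isFiniteMeasure_withDensity hs.lintegral_lt_top.ne
  have := hfin r hr
  have hneg : Integrable (fun v => -r v) ν := hr.neg
  have := hfin _ hneg
  -- In terms of finite positive measures, r⁺ν = μ + r⁻ν, to which uniqueness of characteristic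
  -- functions applies. Hence r⁻ ≤ r⁺ almost everywhere, impossible where r < 0.
  have hadd : ν.withDensity (fun v => ENNReal.ofReal (r v)) =
      μ + ν.withDensity fun v => ENNReal.ofReal (-r v) := by
    refine Measure.ext_of_charFun (funext fun t => ?_)
    have h1 : charFun (μ + ν.withDensity fun v => ENNReal.ofReal (-r v)) t =
        charFun μ t + charFun (ν.withDensity fun v => ENNReal.ofReal (-r v)) t := by
      have hb : ∀ (κ : Measure V) [IsFiniteMeasure κ],
          Integrable (fun v => Complex.exp (⟪v, t⟫ * Complex.I)) κ := fun κ _ => by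
        simpa using integrable_exp_inner_mul (μ := κ) (integrable_const (1 : ℂ)) t
      simp only [charFun_apply]
      exact integral_add_measure (hb _) (hb _)
    rw [h1, h, charFun_withDensity_ofReal hr, charFun_withDensity_ofReal hneg]
    have i1 : Integrable (fun v => Complex.exp (⟪v, t⟫ * Complex.I) * (r v : ℂ)) ν :=
      integrable_exp_inner_mul hr.ofReal t
    have i2 : Integrable (fun v => Complex.exp (⟪v, t⟫ * Complex.I) * ((max (-r v) 0 : ℝ) : ℂ)) ν :=
      integrable_exp_inner_mul hneg.pos_part.ofReal t
    rw [← integral_add i1 i2]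
    refine integral_congr_ae (Eventually.of_forall fun v => ?_)
    have e : ((max (r v) 0 : ℝ) : ℂ) = r v + ((max (-r v) 0 : ℝ) : ℂ) := by
      rw [← Complex.ofReal_add]
      congr 1
      linarith [max_zero_sub_max_neg_zero_eq_self (r v)]
    simp only [e, mul_add]
  have hle : (fun v => ENNReal.ofReal (-r v)) ≤ᵐ[ν] fun v => ENNReal.ofReal (r v) := by
    refine ae_le_of_forall_setLIntegral_le_of_sigmaFinite₀
      hr.neg.1.aemeasurable.ennreal_ofReal fun s hs _ => ?_
    have h1 := congrArg (fun κ : Measure V => κ s) hadd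
    simp only [Measure.add_apply, withDensity_apply _ hs] at h1
    rw [h1]
    exact le_add_self
  filter_upwards [hle] with v hv
  by_contra! hneg
  simp only [Pi.zero_apply] at hneg
  rw [ENNReal.ofReal_of_nonpos hneg.le, nonpos_iff_eq_zero, ENNReal.ofReal_eq_zero] at hv
  linarith

/-- Since μ is real, p and its conjugate have the same transform. So Re p has the transform of μ and
Im p that of 0; the real case applied to Re p and, with μ = 0, to ±Im p concludes. -/
lemma ae_nonneg_of_integral_eq_charFun_complex {ν μ : Measure V} [SigmaFinite ν] [IsFiniteMeasure μ]
    {p : V → ℂ} (hp : Integrable p ν)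
    (h : ∀ t, charFun μ t = ∫ v, Complex.exp (⟪v, t⟫ * Complex.I) * p v ∂ν) :
    0 ≤ᵐ[ν] p := by
  have hconj : ∀ t, charFun μ t = ∫ v, Complex.exp (⟪v, t⟫ * Complex.I) * conj (p v) ∂ν := by
    intro t
    rw [← neg_neg t, charFun_neg, h, ← integral_conj]
    refine integral_congr_ae (Eventually.of_forall fun v => ?_)
    simp [← Complex.exp_conj]
  have hpc : Integrable (fun v => conj (p v)) ν :=
    (LinearIsometryEquiv.integrable_comp_iff Complex.conjLIE).2 hp
  have hre : ∀ t, charFun μ t = ∫ v, Complex.exp (⟪v, t⟫ * Complex.I) * ((p v).re : ℂ) ∂ν := by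
    intro t
    have e : ∀ v, Complex.exp (⟪v, t⟫ * Complex.I) * ((p v).re : ℂ) = (1 / 2 : ℂ) *
        (Complex.exp (⟪v, t⟫ * Complex.I) * p v + Complex.exp (⟪v, t⟫ * Complex.I) * conj (p v)) := by
      intro v
      rw [← mul_add, Complex.add_conj]
      push_cast
      ring
    simp_rw [e]
    rw [integral_const_mul, integral_add (integrable_exp_inner_mul hp t)
      (integrable_exp_inner_mul hpc t), ← h, ← hconj]
    ring
  have him : ∀ t, ∫ v, Complex.exp (⟪v, t⟫ * Complex.I) * ((p v).im : ℂ) ∂ν = 0 := by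
    intro t
    have e : ∀ v, Complex.exp (⟪v, t⟫ * Complex.I) * ((p v).im : ℂ) = (1 / (2 * Complex.I) : ℂ) *
        (Complex.exp (⟪v, t⟫ * Complex.I) * p v - Complex.exp (⟪v, t⟫ * Complex.I) * conj (p v)) := by
      intro v
      rw [← mul_sub, Complex.sub_conj]
      push_cast
      field_simp
    simp_rw [e]
    rw [integral_const_mul, integral_sub (integrable_exp_inner_mul hp t)
      (integrable_exp_inner_mul hpc t), ← h, ← hconj, sub_self, mul_zero]
  have h1 := ae_nonneg_of_integral_eq_charFun hp.re hre
  have h2 := ae_nonneg_of_integral_eq_charFun (μ := (0 : Measure V)) hp.im fun t => by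
    rw [charFun_zero_measure]; exact (him t).symm
  have h3 := ae_nonneg_of_integral_eq_charFun (μ := (0 : Measure V)) hp.im.neg fun t => by
    rw [charFun_zero_measure]
    simp only [Pi.neg_apply, Complex.ofReal_neg, mul_neg, integral_neg]
    rw [eq_comm, neg_eq_zero]
    exact him t
  filter_upwards [h1, h2, h3] with v hv1 hv2 hv3
  refine Complex.nonneg_iff.2 ⟨hv1, ?_⟩
  have a2 : 0 ≤ (p v).im := hv2
  have a3 : 0 ≤ -(p v).im := hv3
  linarith

end FourierUniqueness

/-! ### Physical filters are positive definite -/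

section Filtering

open Filter Topology
open scoped ComplexOrder RealInnerProductSpace FourierTransform

variable {Ω : ℂ → ℂ} {E : TraceClass →ₗ[ℂ] TraceClass}

/-- A rank-one operator as a trace-class operator. -/
noncomputable def rankOneTC (u v : Fock) : TraceClass :=
  ⟨InnerProductSpace.rankOne ℂ u v, rankOne_mem_traceClass u v⟩

lemma charFn_rankOneTC (u v : Fock) (ξ : ℂ) :
    charFn (rankOneTC u v) ξ = ⟪v, displacement ξ u⟫_ℂ :=
  opTrace_rankOne_comp u v _

namespace IsFilteringMap

/-- A rank-one block is positive, so its image is positive on every tuple (D(-ξᵢ)|m⟩)ᵢ; summing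
these inequalities over m yields the quadratic form of Ω. -/
lemma isPosDefFun (hE : IsFilteringMap Ω E) (hCP : IsCompletelyPositive E) : IsPosDefFun Ω := by
  intro n ξ c
  let u : Fin n → Fock := fun k => c k • displacement (-ξ k) (numberState 0)
  have hblock : IsPositiveBlock fun i j => rankOneTC (u i) (u j) := by
    rw [isPositiveBlock_iff]
    intro x
    have e : ∑ i, ∑ j, ⟪x i, (rankOneTC (u i) (u j) : Fock →L[ℂ] Fock) (x j)⟫_ℂ =
        conj (∑ i, ⟪u i, x i⟫_ℂ) * ∑ j, ⟪u j, x j⟫_ℂ := by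
      rw [map_sum, Finset.sum_mul_sum]
      refine Finset.sum_congr rfl fun i _ => Finset.sum_congr rfl fun j _ => ?_
      simp only [rankOneTC, InnerProductSpace.rankOne_apply, inner_smul_right, inner_conj_symm]
      ring
    rw [e, Complex.conj_mul', ← Complex.ofReal_pow]
    exact Complex.zero_le_real.2 (sq_nonneg _)
  have hpos := isPositiveBlock_iff.1 (hCP n _ hblock)
  -- Read in the basis D(-ξᵢ)|m⟩, this is the trace of E(|uᵢ⟩⟨uⱼ|) D(-ξⱼ)D(ξᵢ). The Weyl phase taken
  -- out to reach the characteristic function is put back in ⟨uⱼ, D(-ξⱼ)D(ξᵢ)uᵢ⟩ = c̄ⱼcᵢ.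
  have hterm : ∀ i j, HasSum (fun m => ⟪displacement (-ξ i) (numberState m),
      (E (rankOneTC (u i) (u j)) : Fock →L[ℂ] Fock) (displacement (-ξ j) (numberState m))⟫_ℂ)
      (conj (c j) * c i * Ω (ξ i - ξ j)) := by
    intro i j
    have h := hasSum_opTrace_comp (E (rankOneTC (u i) (u j))).2
      (displacement (-ξ j) ∘L displacement (ξ i)) (displacedBasis (-ξ i))
    simp only [displacedBasis_apply, ContinuousLinearMap.comp_apply, displacement_apply_neg] at h
    convert h using 1
    have hw := displacement_mul (-ξ j) (ξ i)
    rw [show -ξ j + ξ i = ξ i - ξ j by ring] at hw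
    have hu : ⟪u j, (displacement (-ξ j) ∘L displacement (ξ i)) (u i)⟫_ℂ = conj (c j) * c i := by
      simp only [u, ContinuousLinearMap.comp_apply, map_smul, displacement_apply_neg,
        inner_smul_left, inner_smul_right, inner_self_eq_norm_sq_to_K, norm_displacement_apply,
        norm_numberState]
      simp [mul_comm]
    have htr : ∀ (T : Fock →L[ℂ] Fock) (z : ℂ) (η : ℂ), opTrace (T ∘L (z • displacement η)) =
        z * charFn T η := fun T z η => by
      simp only [charFn, opTrace, ContinuousLinearMap.comp_apply, _root_.smul_apply, map_smul,
        inner_smul_right, tsum_mul_left]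
    rw [hw, htr, hE, charFn_rankOneTC, ← hu, hw, _root_.smul_apply, inner_smul_right]
    ring
  have hsum : HasSum (fun m => ∑ i, ∑ j, ⟪displacement (-ξ i) (numberState m),
      (E (rankOneTC (u i) (u j)) : Fock →L[ℂ] Fock) (displacement (-ξ j) (numberState m))⟫_ℂ)
      (∑ i, ∑ j, conj (c j) * c i * Ω (ξ i - ξ j)) :=
    hasSum_sum fun i _ => hasSum_sum fun j _ => hterm i j
  rw [Finset.sum_comm]
  exact hsum.nonneg fun m => hpos fun i => displacement (-ξ i) (numberState m)

/-- Near ξ₀, Ω is the quotient of the characteristic functions of E(ρ) and ρ for ρ = |0⟩⟨D(ξ₀)0|,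
chosen so that the denominator is 1 at ξ₀. -/
lemma continuous (hE : IsFilteringMap Ω E) : Continuous Ω := by
  rw [continuous_iff_continuousAt]
  intro ξ₀
  let ρ := rankOneTC (numberState 0) (displacement ξ₀ (numberState 0))
  have h0 : charFn ρ ξ₀ = 1 := by
    rw [charFn_rankOneTC, inner_self_eq_norm_sq_to_K, norm_displacement_apply, norm_numberState]
    simp
  have h1 := (continuous_charFn ρ.2).continuousAt (x := ξ₀)
  have h2 := (continuous_charFn (E ρ).2).continuousAt (x := ξ₀)
  refine (h2.div h1 (by rw [h0]; exact one_ne_zero)).congr ?_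
  filter_upwards [h1.eventually_ne (y := 0) (by rw [h0]; exact one_ne_zero)] with ξ hξ
  simp only [Pi.div_apply]
  rw [hE, mul_div_cancel_left₀ _ hξ]

lemma apply_zero (hE : IsFilteringMap Ω E) (hTP : IsTracePreserving E) : Ω 0 = 1 := by
  have h := hE (rankOneTC (numberState 0) (numberState 0)) 0
  have h1 : charFn (rankOneTC (numberState 0) (numberState 0)) 0 = 1 := by
    rw [charFn_rankOneTC, displacement_zero, ContinuousLinearMap.id_apply,
      inner_self_eq_norm_sq_to_K, norm_numberState]
    simp
  rw [charFn_zero, hTP, ← charFn_zero, h1, one_mul] at h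
  exact h.symm

end IsFilteringMap

lemma fourierKernel_eq_exp_inner (ξ α : ℂ) :
    fourierKernel ξ α = Complex.exp (⟪α, -2 * Complex.I * ξ⟫ * Complex.I) := by
  rw [fourierKernel, Complex.inner]
  congr 1
  apply Complex.ext <;> simp <;> ring

lemma integral_fourierKernel (μ : Measure ℂ) (ξ : ℂ) :
    ∫ α, fourierKernel ξ α ∂μ = charFun μ (-2 * Complex.I * ξ) := by
  simp_rw [charFun_apply, fourierKernel_eq_exp_inner]

/-- The measure of a physical filter. -/
lemma exists_measure_of_isCPTP (hE : IsFilteringMap Ω E) (h : IsCPTP E) :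
    ∃ μ : Measure ℂ, IsProbabilityMeasure μ ∧ ∀ ξ, Ω ξ = ∫ α, fourierKernel ξ α ∂μ := by
  have hpi : (Real.pi : ℂ) ≠ 0 := by exact_mod_cast Real.pi_ne_zero
  -- The scaling solves -2iξ = 2πt for ξ = πit, matching the kernel to the normalization in
  -- `exists_charFun_eq`.
  have hpd : IsPosDefFun fun t : ℂ => Ω (Real.pi * Complex.I * t) := fun n x c => by
    simpa only [mul_sub] using hE.isPosDefFun h.1 n (fun k => Real.pi * Complex.I * x k) c
  obtain ⟨μ, hμ, hμf⟩ := hpd.exists_charFun_eq (hE.continuous.comp (by fun_prop))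
    (by rw [mul_zero]; exact hE.apply_zero h.2)
  refine ⟨μ, hμ, fun ξ => ?_⟩
  have h1 := hμf ((Real.pi * Complex.I)⁻¹ * ξ)
  have hne : (Real.pi * Complex.I : ℂ) ≠ 0 := mul_ne_zero hpi Complex.I_ne_zero
  rw [mul_inv_cancel_left₀ hne] at h1
  rw [integral_fourierKernel, ← h1]
  congr 1
  rw [Complex.real_smul, mul_inv, Complex.inv_I]
  push_cast
  field_simp

lemma isProbabilityDensity_iff {p : ℂ → ℂ} :
    IsProbabilityDensity p ↔ Integrable p ∧ 0 ≤ᵐ[volume] p ∧ ∫ α, p α = 1 := by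
  refine and_congr_right fun _ => and_congr_left fun _ => ?_
  refine ⟨fun h => ?_, fun h => ?_⟩
  · filter_upwards [h] with α hα
    exact Complex.nonneg_iff.2 ⟨hα.1, hα.2.symm⟩
  · filter_upwards [h] with α hα
    have := Complex.nonneg_iff.1 hα
    exact ⟨this.1, this.2.symm⟩

lemma isProbabilityDensity_of_isCPTP {p : ℂ → ℂ} (hp : Integrable p)
    (hΩ : ∀ ξ, Ω ξ = ∫ α, fourierKernel ξ α * p α) (hE : IsFilteringMap Ω E) (h : IsCPTP E) :
    IsProbabilityDensity p := by
  obtain ⟨μ, hμ, hμΩ⟩ := exists_measure_of_isCPTP hE h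
  refine isProbabilityDensity_iff.2 ⟨hp, ae_nonneg_of_integral_eq_charFun_complex (μ := μ) hp
    fun t => ?_, ?_⟩
  · have h1 := hμΩ ((-2 * Complex.I)⁻¹ * t)
    have hne : (-2 * Complex.I : ℂ) ≠ 0 := by simp
    rw [hΩ, integral_fourierKernel, mul_inv_cancel_left₀ hne] at h1
    simp_rw [fourierKernel_eq_exp_inner, mul_inv_cancel_left₀ hne] at h1
    exact h1.symm
  · have h1 := hE.apply_zero h.2
    rw [hΩ] at h1
    simpa [fourierKernel] using h1

/-! ### Symplectic Fourier inversion and integrable filters -/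

lemma measurePreserving_I_mul : MeasurePreserving (fun α : ℂ => Complex.I * α) volume volume :=
  (rotation (⟨Complex.I, by simp [Submonoid.unitSphere]⟩ : Circle)).measurePreserving

lemma measurableEmbedding_I_mul : MeasurableEmbedding (fun α : ℂ => Complex.I * α) :=
  (Homeomorph.mulLeft₀ Complex.I Complex.I_ne_zero).measurableEmbedding

/-- Multiplication by i preserves area and division by π scales it by 1/π², which accounts for the
prefactor of the symplectic transform. -/
lemma integral_comp_I_div_pi (G : ℂ → ℂ) :
    1 / (Real.pi : ℂ) ^ 2 * ∫ α, G (Complex.I * α / Real.pi) = ∫ w, G w := by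
  have h1 := measurePreserving_I_mul.integral_comp measurableEmbedding_I_mul
    (fun α => G (α / Real.pi))
  have h2 := Measure.integral_comp_smul (volume : Measure ℂ) G (Real.pi⁻¹)
  rw [Complex.finrank_real_complex] at h2
  have e : ∀ α : ℂ, Real.pi⁻¹ • α = α / Real.pi := fun α => by
    rw [Complex.real_smul, Complex.ofReal_inv, inv_mul_eq_div]
  simp_rw [e] at h2
  have hpi : (Real.pi : ℂ) ≠ 0 := by exact_mod_cast Real.pi_ne_zero
  rw [h1, h2, abs_of_pos (by positivity), Complex.real_smul]
  push_cast
  field_simp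

lemma integrable_comp_I_div_pi_iff (G : ℂ → ℂ) :
    Integrable (fun α : ℂ => G (Complex.I * α / Real.pi)) ↔ Integrable G := by
  have h1 := measurePreserving_I_mul.integrable_comp_emb measurableEmbedding_I_mul
    (g := fun α => G (α / Real.pi))
  have h2 := integrable_comp_smul_iff (volume : Measure ℂ) G (inv_ne_zero Real.pi_ne_zero)
  have e : ∀ α : ℂ, Real.pi⁻¹ • α = α / Real.pi := fun α => by
    rw [Complex.real_smul, Complex.ofReal_inv, inv_mul_eq_div]
  simp_rw [e] at h2
  exact h1.trans h2

/-- The symplectic Fourier transform, in terms of the usual one. -/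
lemma integral_mul_fourierKernel (Ω : ℂ → ℂ) (α : ℂ) :
    ∫ ξ, Ω ξ * fourierKernel α ξ = 𝓕 Ω (Complex.I * α / Real.pi) := by
  rw [Real.fourier_eq']
  refine integral_congr_ae (Eventually.of_forall fun ξ => ?_)
  simp only [smul_eq_mul, fourierKernel_eq_exp_inner]
  rw [mul_comm]
  congr 4
  have e : Complex.I * α / (Real.pi : ℂ) = Real.pi⁻¹ • (Complex.I * α) := by
    rw [Complex.real_smul, Complex.ofReal_inv, inv_mul_eq_div]
  have e' : -2 * Complex.I * α = (-2 : ℝ) • (Complex.I * α) := by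
    rw [Complex.real_smul]; push_cast; ring
  rw [e, e', real_inner_smul_right, real_inner_smul_right]
  field_simp

/-- Fourier inversion for the symplectic Fourier transform. -/
lemma eq_integral_fourierKernel_mul (hc : Continuous Ω) (hi : Integrable Ω) (hF : Integrable (𝓕 Ω))
    (ξ : ℂ) :
    Ω ξ = ∫ α, fourierKernel ξ α * (1 / (Real.pi : ℂ) ^ 2 * ∫ η, Ω η * fourierKernel α η) := by
  simp_rw [integral_mul_fourierKernel, mul_left_comm (fourierKernel _ _)]
  rw [integral_const_mul]
  have h := congrFun (hc.fourierInv_fourier_eq hi hF) ξ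
  rw [fourierInv_eq_integral_exp, ← integral_comp_I_div_pi] at h
  rw [← h]
  congr 1
  refine integral_congr_ae (Eventually.of_forall fun α => ?_)
  simp only [fourierKernel_eq_exp_inner]
  congr 4
  have hpi : Real.pi ≠ 0 := Real.pi_ne_zero
  rw [real_inner_smul_right, Complex.inner, Complex.inner, Complex.div_ofReal]
  simp
  field_simp

lemma isProbabilityDensity_iff_of_continuous (hc : Continuous Ω) (hi : Integrable Ω) :
    (∃ E : TraceClass →ₗ[ℂ] TraceClass, IsFilteringMap Ω E ∧ IsCPTP E) ↔
      IsProbabilityDensity fun α => 1 / (Real.pi : ℂ) ^ 2 * ∫ ξ, Ω ξ * fourierKernel α ξ := by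
  have hpi : (1 / (Real.pi : ℂ) ^ 2) ≠ 0 := by
    have : (Real.pi : ℂ) ≠ 0 := by exact_mod_cast Real.pi_ne_zero
    positivity
  have hint : Integrable (fun α => 1 / (Real.pi : ℂ) ^ 2 * ∫ ξ, Ω ξ * fourierKernel α ξ) ↔
      Integrable (𝓕 Ω) := by
    simp_rw [integral_mul_fourierKernel]
    rw [← integrable_comp_I_div_pi_iff (𝓕 Ω)]
    exact integrable_const_mul_iff (IsUnit.mk0 _ hpi) _
  constructor
  · rintro ⟨E, hE, h⟩
    -- Inversion needs 𝓕 Ω integrable; physicality provides this through positive definiteness.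
    have hF := integrable_fourier_of_nonneg hc hi ((hE.isPosDefFun h.1).fourier_nonneg hc hi)
    exact isProbabilityDensity_of_isCPTP (hint.2 hF) (eq_integral_fourierKernel_mul hc hi hF) hE h
  · intro hp
    obtain ⟨hp1, hp2, hp3⟩ := isProbabilityDensity_iff.1 hp
    exact ⟨twirlTraceClass hp1, isFilteringMap_of_isWeakTwirl hp1 (isWeakTwirl_twirlTraceClass hp1)
      (eq_integral_fourierKernel_mul hc hi (hint.1 hp1)),
      isCPTP_of_isWeakTwirl hp1 hp2 hp3 (isWeakTwirl_twirlTraceClass hp1)⟩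

end Filtering

theorem theorem1 (Ω : ℂ → ℂ) :
    -- An arbitrary filter: physicality means that `Ω` is the Fourier transform of a
    -- probability distribution on the complex plane.
    ((∃ E : TraceClass →ₗ[ℂ] TraceClass, IsFilteringMap Ω E ∧ IsCPTP E) ↔
      ∃ μ : Measure ℂ, IsProbabilityMeasure μ ∧ ∀ ξ, Ω ξ = ∫ α, fourierKernel ξ α ∂μ) ∧
    -- A filter whose Fourier transform `p` is an integrable function.
    (∀ p : ℂ → ℂ, Integrable p → (∀ ξ, Ω ξ = ∫ α, fourierKernel ξ α * p α) →
      (∃ E : TraceClass →ₗ[ℂ] TraceClass, IsDisplacementIntegral p E) ∧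
      ∀ E : TraceClass →ₗ[ℂ] TraceClass, IsDisplacementIntegral p E →
        IsFilteringMap Ω E ∧ (IsCPTP E ↔ IsProbabilityDensity p)) ∧
    -- A continuous integrable filter, with its Fourier transform given by the Fourier integral.
    (Continuous Ω → Integrable Ω →
      ((∃ E : TraceClass →ₗ[ℂ] TraceClass, IsFilteringMap Ω E ∧ IsCPTP E) ↔
        IsProbabilityDensity fun α =>
          1 / (Real.pi : ℂ) ^ 2 * ∫ ξ, Ω ξ * fourierKernel α ξ)) := by
  refine ⟨⟨fun ⟨E, hE, h⟩ => exists_measure_of_isCPTP hE h, ?_⟩, fun p hp hΩ => ?_,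
    isProbabilityDensity_iff_of_continuous⟩
  · rintro ⟨μ, hμ, hΩ⟩
    -- Constant weight 1 against μ itself, so that μ need not have a density.
    have h1 : Integrable (fun _ : ℂ => (1 : ℂ)) μ := integrable_const 1
    refine ⟨twirlTraceClass h1, isFilteringMap_of_isWeakTwirl h1 (isWeakTwirl_twirlTraceClass h1)
      (by simpa using hΩ), isCPTP_of_isWeakTwirl h1 ?_ (by simp) (isWeakTwirl_twirlTraceClass h1)⟩
    exact Filter.Eventually.of_forall fun _ => (by simp [Complex.le_def])
  · refine ⟨⟨twirlTraceClass hp, isDisplacementIntegral_iff.2 (isWeakTwirl_twirlTraceClass hp)⟩,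
      fun E hE => ?_⟩
    rw [isDisplacementIntegral_iff] at hE
    have hF := isFilteringMap_of_isWeakTwirl hp hE hΩ
    refine ⟨hF, fun h => isProbabilityDensity_of_isCPTP hp hΩ hF h, fun h => ?_⟩
    obtain ⟨-, h0, h1⟩ := isProbabilityDensity_iff.1 h
    exact isCPTP_of_isWeakTwirl hp h0 h1 hE
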